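/- Setting. Let $\mathcal A$ be a finite non-empty set and let $(\bar O_t)_{t\ge1}$, $\bar O_t=(O_{\alpha,t})_{\alpha\in\mathcal A}$, be random elements of $\mathcal O^{\mathcal A}$ ($\mathcal O$ a measurable space) on a probability space $(\Omega,\mathbb P)$. Let $F_{t}=\sigma(O_{\alpha,\tau}:\alpha\in\mathcal A,1\le\tau\le t)$ ($F_0$ trivial) and $\bar Z_t=(Z_{\alpha,t})_{\alpha\in\mathcal A}=S(\bar O_t)\in\mathcal Z^{\mathcal A}$ for a fixed measurable map $S$. Let $\Theta$ be a measurable parameter space and $\ell(\theta)(o,z)\in\mathbb R$ a jointly measurable loss, such that all $\ell(\theta)(O_{\alpha,t},Z_{\alpha,t})$ are square integrable. Fix $\theta^\circ\in\Theta$, put $\Delta^\circ\ell(\theta)=\ell(\theta)-\ell(\theta^\circ)$ and $\bar\ell(\theta)(\bar O_t,\bar Z_t)=\frac1{|\mathcal A|}\sum_{\alpha}\ell(\theta)(O_{\alpha,t},Z_{\alpha,t})$, and define $\Delta^\circ\bar\ell$ likewise. Below, $\eta$ ranges over all $F_{t-1}$-measurable $\Theta$-valued random variables (in particular all constants $\theta\in\Theta$),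 and $\ell(\eta)$ is short for $\ell(\eta)(O_{\alpha,t},Z_{\alpha,t})$; all (in)equalities between conditional expectations are almost sure. Assumptions. (A0) $\mathcal G$ is a graph on $\mathcal A$ such that, for all $t\ge1$, if $\alpha\notin\mathcal A'\subset\mathcal A$ has no edge to any vertex of $\mathcal A'$, then $O_{\alpha,t}$ is conditionally independent of $(O_{\alpha',t})_{\alpha'\in\mathcal A'}$ given $(\bar Z_t,F_{t-1})$; $\deg(\mathcal G)$ is $1$ plus the maximum degree of $\mathcal G$. (A1) For all $t\ge1$, $\eta$ and $\theta\in\Theta$: $\mathbb E[\ell(\eta)\mid\bar Z_t,F_{t-1}]=\mathbb E[\ell(\eta)\mid Z_{\alpha,t},F_{t-1}]$ for each $\alpha$, and, for all integers $\varepsilon_1,\varepsilon_2\ge0$ with $\varepsilon_1+\varepsilon_2=2$, $\mathbb E[\sum_\alpha\ell(\eta)^{\varepsilon_1}\ell(\theta)^{\varepsilon_2}\mid\bar Z_t,F_{t-1}]=\sum_\alpha\mathbb E[\ell(\eta)^{\varepsilon_1}\ell(\theta)^{\varepsilon_2}\mid Z_{\alpha,t},F_{t-1}]$. (A2) There are $b_1>0$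 and $b_2\in(0,2b_1]$ with $\sup_\theta\|\Delta^\circ\ell(\theta)\|_\infty\le b_1$ and, for all $\alpha$, $t\ge1$, $\eta$, $|\Delta^\circ\ell(\eta)-\mathbb E[\Delta^\circ\ell(\eta)\mid Z_{\alpha,t},F_{t-1}]|\le b_2$ a.s. (A3) There are $\beta\in(0,1]$, $\gamma>0$ such that, for all $\alpha$, $t\ge1$, $\eta$, $\mathbb E[\Delta^\circ\ell(\eta)\mid Z_{\alpha,t},F_{t-1}]\ge0$ and $\mathbb E[(\Delta^\circ\ell(\eta))^2\mid Z_{\alpha,t},F_{t-1}]\le\gamma\,(\mathbb E[\Delta^\circ\ell(\eta)\mid Z_{\alpha,t},F_{t-1}])^\beta$ a.s. Let $(\theta_{j,t})_{t\ge0}$, $1\le j\le J$, be sequences of $\Theta$-valued random variables with $\theta_{j,t}$ $F_t$-measurable. Set $\widehat R_{j,t}=\frac1t\sum_{\tau=1}^t\bar\ell(\theta_{j,\tau-1})(\bar O_\tau,\bar Z_\tau)$ and $\widetilde R_{j,t}=\frac1t\sum_{\tau=1}^t\mathbb E[\bar\ell(\theta_{j,\tau-1})(\bar O_\tau,\bar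 Z_\tau)\mid\bar Z_\tau,F_{\tau-1}]$, let $\widehat R_t(\theta^\circ)$, $\widetilde R_t(\theta^\circ)$ be the same quantities with every $\theta_{j,\tau-1}$ replaced by $\theta^\circ$, and set $\mathrm{var}_{j,\tau}=\frac1{|\mathcal A|}\sum_\alpha\mathrm{Var}[\Delta^\circ\ell(\theta_{j,\tau-1})(O_{\alpha,\tau},Z_{\alpha,\tau})\mid Z_{\alpha,\tau},F_{\tau-1}]$, $\widetilde{\mathrm{var}}_{j,t}=\frac1t\sum_{\tau=1}^t\mathrm{Var}[\Delta^\circ\bar\ell(\theta_{j,\tau-1})(\bar O_\tau,\bar Z_\tau)\mid\bar Z_\tau,F_{\tau-1}]$. Theorem. Assume A0–A3 and let $j\in\{1,\dots,J\}$, $t\ge1$. (1) If $v_1>0$ is such that $\mathrm{Var}[\Delta^\circ\ell(\eta)\mid Z_{\alpha,s},F_{s-1}]\le v_1$ a.s. for all $\alpha$, $s\ge1$ and all $F_{s-1}$-measurable $\eta$, then almost surely $$\widetilde{\mathrm{var}}_{j,t}\le v_2:=\frac{3\pi}2\left[\left(\frac{15b_2}{|\mathcal A|/\deg(\mathcal G)}\right)^2+\frac{64v_1}{|\mathcal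 A|/\deg(\mathcal G)}\right].$$ (2) For all $V>0$ and $x\ge0$, $$\mathbb P\Big[\big|[\widehat R_{j,t}-\widehat R_t(\theta^\circ)]-[\widetilde R_{j,t}-\widetilde R_t(\theta^\circ)]\big|\ge x,\ \max_{1\le\tau\le t}\mathrm{var}_{j,\tau}\le V\Big]\le\exp\left(2-\frac{[|\mathcal A|/\deg(\mathcal G)]\,x^2}{32e^2V+15e\,b_2x}\right).$$ -/

import Mathlib

open MeasureTheory ProbabilityTheory

namespace SequentialSL

noncomputable section

section

variable {Ω A O Z Θ : Type*} [MeasurableSpace O] [MeasurableSpace Z]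

/-- The σ-field `F_t` generated by the observations `O_{α,τ}`, `α ∈ A`, `1 ≤ τ ≤ t`;
`F_0` is the trivial σ-field. Here `obs τ ω α` is `O_{α,τ}(ω)`. -/
def past (obs : ℕ → Ω → A → O) (t : ℕ) : MeasurableSpace Ω :=
  ⨆ τ ∈ Finset.Icc 1 t, MeasurableSpace.comap (obs τ) inferInstance

/-- The summary `Z_{α,t}`, the `α`-component of `Z̄_t = S(Ō_t)`. -/
def summ (S : (A → O) → A → Z) (obs : ℕ → Ω → A → O) (α : A) (t : ℕ) (ω : Ω) : Z :=
  S (obs t ω) α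

/-- The σ-field generated by `Z̄_t = (Z_{α,t})_{α ∈ A}` and `F_{t-1}`. -/
def jointInfo (S : (A → O) → A → Z) (obs : ℕ → Ω → A → O) (t : ℕ) : MeasurableSpace Ω :=
  MeasurableSpace.comap (fun ω α => summ S obs α t ω) inferInstance ⊔ past obs (t - 1)

/-- The σ-field generated by the single `Z_{α,t}` and `F_{t-1}`. -/
def localInfo (S : (A → O) → A → Z) (obs : ℕ → Ω → A → O) (α : A) (t : ℕ) :
    MeasurableSpace Ω :=
  MeasurableSpace.comap (summ S obs α t) inferInstance ⊔ past obs (t - 1)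

/-- `ℓ(η)(O_{α,t}, Z_{α,t})` for a possibly random parameter `η`. -/
def lossAt (loss : Θ → O → Z → ℝ) (S : (A → O) → A → Z) (obs : ℕ → Ω → A → O)
    (η : Ω → Θ) (α : A) (t : ℕ) (ω : Ω) : ℝ :=
  loss (η ω) (obs t ω α) (summ S obs α t ω)

/-- The loss difference `Δ°ℓ(η)(O_{α,t}, Z_{α,t}) = ℓ(η)(…) - ℓ(θ°)(…)`. -/
def diffAt (loss : Θ → O → Z → ℝ) (S : (A → O) → A → Z) (obs : ℕ → Ω → A → O) (θ₀ : Θ)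
    (η : Ω → Θ) (α : A) (t : ℕ) (ω : Ω) : ℝ :=
  lossAt loss S obs η α t ω - lossAt loss S obs (fun _ => θ₀) α t ω

variable [Fintype A]

/-- The averaged loss `ℓ̄(η)(Ō_t, Z̄_t)`. -/
def avgLoss (loss : Θ → O → Z → ℝ) (S : (A → O) → A → Z) (obs : ℕ → Ω → A → O)
    (η : Ω → Θ) (t : ℕ) (ω : Ω) : ℝ :=
  1 / (Fintype.card A : ℝ) * ∑ α, lossAt loss S obs η α t ω

/-- The averaged loss difference `Δ°ℓ̄(η)(Ō_t, Z̄_t) = ℓ̄(η)(…) - ℓ̄(θ°)(…)`. -/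
def avgDiff (loss : Θ → O → Z → ℝ) (S : (A → O) → A → Z) (obs : ℕ → Ω → A → O) (θ₀ : Θ)
    (η : Ω → Θ) (t : ℕ) (ω : Ω) : ℝ :=
  avgLoss loss S obs η t ω - avgLoss loss S obs (fun _ => θ₀) t ω

/-- The empirical risk `R̂_t` of the sequence of parameters `θ_0, θ_1, …`. -/
def empRisk (loss : Θ → O → Z → ℝ) (S : (A → O) → A → Z) (obs : ℕ → Ω → A → O)
    (θ : ℕ → Ω → Θ) (t : ℕ) (ω : Ω) : ℝ :=
  1 / (t : ℝ) * ∑ τ ∈ Finset.Icc 1 t, avgLoss loss S obs (θ (τ - 1)) τ ω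

/-- `deg(G)`: one plus the maximum degree of the graph. -/
def deg (G : SimpleGraph A) [DecidableRel G.Adj] : ℝ := 1 + (G.maxDegree : ℝ)

/-- The constant `v₂`. -/
def v₂ (G : SimpleGraph A) [DecidableRel G.Adj] (b₂ v₁ : ℝ) : ℝ :=
  3 * Real.pi / 2 *
    ((15 * b₂ / ((Fintype.card A : ℝ) / deg G)) ^ 2 +
      64 * v₁ / ((Fintype.card A : ℝ) / deg G))

variable [MeasurableSpace Ω]

/-- The conditional risk `R̃_t` of the sequence of parameters `θ_0, θ_1, …`. -/
def risk (P : Measure Ω) (loss : Θ → O → Z → ℝ) (S : (A → O) → A → Z)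
    (obs : ℕ → Ω → A → O) (θ : ℕ → Ω → Θ) (t : ℕ) (ω : Ω) : ℝ :=
  1 / (t : ℝ) * ∑ τ ∈ Finset.Icc 1 t,
    (P[avgLoss loss S obs (θ (τ - 1)) τ | jointInfo S obs τ]) ω

/-- The slice variance `var_t`: the average over `α` of the conditional variances of
`Δ°ℓ(θ_{t-1})(O_{α,t}, Z_{α,t})` given `Z_{α,t}` and `F_{t-1}`. -/
def sliceVar (P : Measure Ω) (loss : Θ → O → Z → ℝ) (S : (A → O) → A → Z)
    (obs : ℕ → Ω → A → O) (θ₀ : Θ) (θ : ℕ → Ω → Θ) (t : ℕ) (ω : Ω) : ℝ :=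
  1 / (Fintype.card A : ℝ) * ∑ α,
    (Var[diffAt loss S obs θ₀ (θ (t - 1)) α t ; P | localInfo S obs α t]) ω

/-- The time-averaged conditional variance of `Δ°ℓ̄(θ_{τ-1})(Ō_τ, Z̄_τ)` given `Z̄_τ` and
`F_{τ-1}`. -/
def timeVar (P : Measure Ω) (loss : Θ → O → Z → ℝ) (S : (A → O) → A → Z)
    (obs : ℕ → Ω → A → O) (θ₀ : Θ) (θ : ℕ → Ω → Θ) (t : ℕ) (ω : Ω) : ℝ :=
  1 / (t : ℝ) * ∑ τ ∈ Finset.Icc 1 t,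
    (Var[avgDiff loss S obs θ₀ (θ (τ - 1)) τ ; P | jointInfo S obs τ]) ω

end

section

variable {Ω A O Z Θ : Type*} [mΩ : MeasurableSpace Ω] [MeasurableSpace O] [MeasurableSpace Z]
  [MeasurableSpace Θ]

/-- Conditional independence of the σ-fields `m₁` and `m₂` given `m`. (Mathlib's notion is
restricted to standard Borel spaces `Ω`, where it is equivalent to this one.) -/
def CondIndepGiven (P : Measure Ω) (m m₁ m₂ : MeasurableSpace Ω) : Prop :=
  ∀ s t : Set Ω, MeasurableSet[m₁] s → MeasurableSet[m₂] t →
    P[(s ∩ t).indicator (fun _ => (1 : ℝ)) | m] =ᵐ[P]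
      P[s.indicator (fun _ => (1 : ℝ)) | m] * P[t.indicator (fun _ => (1 : ℝ)) | m]

/-- `G` is a conditional dependency graph: at every time `t`, whenever `α` is not linked to any
vertex of `A'`, `O_{α,t}` is conditionally independent of `(O_{α',t})_{α' ∈ A'}` given
`Z̄_t` and `F_{t-1}`. -/
def DependencyGraph (P : Measure Ω) (S : (A → O) → A → Z) (obs : ℕ → Ω → A → O)
    (G : SimpleGraph A) : Prop :=
  ∀ t : ℕ, 1 ≤ t → ∀ (α : A) (A' : Set A), α ∉ A' → (∀ α' ∈ A', ¬ G.Adj α α') →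
    CondIndepGiven P (jointInfo S obs t)
      (MeasurableSpace.comap (fun ω => obs t ω α) inferInstance)
      (MeasurableSpace.comap (fun ω (α' : A') => obs t ω α') inferInstance)

/-- Stationarity: for the purpose of first and second moments of the losses, conditioning on all
the summaries is the same as conditioning on the summary at `α`. Every `F_{t-1}`-measurable
parameter `η` and every fixed parameter `θ` is allowed. -/
def Stationarity [Fintype A] (P : Measure Ω) (loss : Θ → O → Z → ℝ) (S : (A → O) → A → Z)
    (obs : ℕ → Ω → A → O) : Prop :=
  ∀ t : ℕ, 1 ≤ t → ∀ η : Ω → Θ, Measurable[past obs (t - 1)] η →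
    (∀ α : A, P[lossAt loss S obs η α t | jointInfo S obs t] =ᵐ[P]
      P[lossAt loss S obs η α t | localInfo S obs α t]) ∧
    ∀ (θ : Θ) (ε₁ ε₂ : ℕ), ε₁ + ε₂ = 2 →
      P[fun ω => ∑ α, lossAt loss S obs η α t ω ^ ε₁ *
          lossAt loss S obs (fun _ => θ) α t ω ^ ε₂ | jointInfo S obs t] =ᵐ[P]
        fun ω => ∑ α, (P[fun ω' => lossAt loss S obs η α t ω' ^ ε₁ *
          lossAt loss S obs (fun _ => θ) α t ω' ^ ε₂ | localInfo S obs α t]) ω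

/-- Boundedness of the loss differences and of the centred loss differences. -/
def Boundedness (P : Measure Ω) (loss : Θ → O → Z → ℝ) (S : (A → O) → A → Z)
    (obs : ℕ → Ω → A → O) (θ₀ : Θ) (b₁ b₂ : ℝ) : Prop :=
  0 < b₁ ∧ (∀ θ o z, |loss θ o z - loss θ₀ o z| ≤ b₁) ∧ 0 < b₂ ∧ b₂ ≤ 2 * b₁ ∧
    ∀ (α : A) (t : ℕ), 1 ≤ t → ∀ η : Ω → Θ, Measurable[past obs (t - 1)] η → ∀ᵐ ω ∂P,
      |diffAt loss S obs θ₀ η α t ω -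
        (P[diffAt loss S obs θ₀ η α t | localInfo S obs α t]) ω| ≤ b₂

/-- The variance bound (Bernstein condition); the base of the real power is nonnegative. -/
def VarianceBound (P : Measure Ω) (loss : Θ → O → Z → ℝ) (S : (A → O) → A → Z)
    (obs : ℕ → Ω → A → O) (θ₀ : Θ) : Prop :=
  ∃ β γ : ℝ, 0 < β ∧ β ≤ 1 ∧ 0 < γ ∧
    ∀ (α : A) (t : ℕ), 1 ≤ t → ∀ η : Ω → Θ, Measurable[past obs (t - 1)] η → ∀ᵐ ω ∂P,
      0 ≤ (P[diffAt loss S obs θ₀ η α t | localInfo S obs α t]) ω ∧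
      (P[fun ω' => diffAt loss S obs θ₀ η α t ω' ^ 2 | localInfo S obs α t]) ω ≤
        γ * ((P[diffAt loss S obs θ₀ η α t | localInfo S obs α t]) ω) ^ β

/-- The conditional variances of the loss differences are at most `v₁`. -/
def CondVarBound (P : Measure Ω) (loss : Θ → O → Z → ℝ) (S : (A → O) → A → Z)
    (obs : ℕ → Ω → A → O) (θ₀ : Θ) (v₁ : ℝ) : Prop :=
  ∀ (α : A) (t : ℕ), 1 ≤ t → ∀ η : Ω → Θ, Measurable[past obs (t - 1)] η → ∀ᵐ ω ∂P,
    (Var[diffAt loss S obs θ₀ η α t ; P | localInfo S obs α t]) ω ≤ v₁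

end

end

end SequentialSL

namespace SequentialSL

/-! ### Conditional independence and factorization of conditional expectations. -/

section CondIndep

variable {Ω : Type*} {m m₁ m₂ : MeasurableSpace Ω} {mΩ : MeasurableSpace Ω} {P : Measure Ω}

/-! Write n for the number of vertices, K = `deg G`, and m for the information in `Z̄_τ` and
`F_{τ-1}`. Centre the loss differences of time τ by their conditional means given m. The parameter
`θ (τ - 1)` is known to m, so A0 makes these centred variables conditionally independent given m
along every independent set of the graph. A greedy colouring splits the vertices into K such sets.

For the variance, the square of the total is at most K times the sum of the squared class sums
(Cauchy–Schwarz), and inside a class the cross terms vanish (`IsCentredSlice.condExp_sq_avg_le`).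
The variance of the average is thus at most K/n times the mean second moment, which A1 identifies
with the slice variance. This already gives `v₁` K/n, well below `v₂`.

For the deviation, exp of the total is bounded by a convex combination over the colours, with
m-measurable weights adapted to the class variances. Each class factorizes, and exp u ≤ 1 + u + u²
for |u| ≤ 1 controls each factor. The outcome is E[exp(r · average) | m] ≤ exp(4 r² (K/n) · slice
variance) for small r (`IsCentredSlice.condExp_exp_avg_le`). In time, these bounds make the
compensated exponential a supermartingale (`measureReal_le_exp_neg_of_condExp_exp_le`). Markov's
inequality, a choice of r and a union over the two signs finish the argument. -/

lemma isPiSystem_inter_measurableSet (m₁ m₂ : MeasurableSpace Ω) :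
    IsPiSystem {u | ∃ s t, MeasurableSet[m₁] s ∧ MeasurableSet[m₂] t ∧ s ∩ t = u} := by
  rintro _ ⟨s, t, hs, ht, rfl⟩ _ ⟨s', t', hs', ht', rfl⟩ -
  exact ⟨s ∩ s', t ∩ t', hs.inter hs', ht.inter ht', by ac_rfl⟩

lemma sup_eq_generateFrom_inter (m₁ m₂ : MeasurableSpace Ω) :
    m₁ ⊔ m₂ = MeasurableSpace.generateFrom
      {u | ∃ s t, MeasurableSet[m₁] s ∧ MeasurableSet[m₂] t ∧ s ∩ t = u} := by
  refine le_antisymm (sup_le ?_ ?_) (MeasurableSpace.generateFrom_le ?_)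
  · exact fun s hs => MeasurableSpace.measurableSet_generateFrom
      ⟨s, Set.univ, hs, MeasurableSet.univ, by simp⟩
  · exact fun s hs => MeasurableSpace.measurableSet_generateFrom
      ⟨Set.univ, s, MeasurableSet.univ, hs, by simp⟩
  · rintro _ ⟨s, t, hs, ht, rfl⟩
    exact MeasurableSet.inter (m := m₁ ⊔ m₂) ((le_sup_left : m₁ ≤ m₁ ⊔ m₂) s hs)
      ((le_sup_right : m₂ ≤ m₁ ⊔ m₂) t ht)

/-- Two integrable functions with the same integral over all intersections of sets from two
σ-fields have the same integral over all sets of the generated σ-field. -/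
lemma setIntegral_eq_of_forall_inter {f g : Ω → ℝ} (h₁ : m₁ ≤ mΩ) (h₂ : m₂ ≤ mΩ)
    (hf : Integrable f P) (hg : Integrable g P)
    (h : ∀ s t, MeasurableSet[m₁] s → MeasurableSet[m₂] t →
      ∫ ω in s ∩ t, f ω ∂P = ∫ ω in s ∩ t, g ω ∂P)
    {u : Set Ω} (hu : MeasurableSet[m₁ ⊔ m₂] u) :
    ∫ ω in u, f ω ∂P = ∫ ω in u, g ω ∂P := by
  have hle : m₁ ⊔ m₂ ≤ mΩ := sup_le h₁ h₂
  have huniv : ∫ ω, f ω ∂P = ∫ ω, g ω ∂P := by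
    simpa using h Set.univ Set.univ MeasurableSet.univ MeasurableSet.univ
  refine MeasurableSpace.induction_on_inter (m := m₁ ⊔ m₂)
    (C := fun u _ => ∫ ω in u, f ω ∂P = ∫ ω in u, g ω ∂P)
    (sup_eq_generateFrom_inter m₁ m₂) (isPiSystem_inter_measurableSet m₁ m₂)
    (by simp) ?_ ?_ ?_ u hu
  · rintro _ ⟨s, t, hs, ht, rfl⟩
    exact h s t hs ht
  · intro t ht hft
    have h1 := integral_add_compl (hle t ht) hf
    have h2 := integral_add_compl (hle t ht) hg
    linarith
  · intro s hd hs hfs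
    rw [integral_iUnion (fun i => hle _ (hs i)) hd hf.integrableOn,
      integral_iUnion (fun i => hle _ (hs i)) hd hg.integrableOn]
    exact tsum_congr hfs

lemma setIntegral_eq_integral_mul_indicator (hm : m ≤ mΩ) {s : Set Ω}
    (hs : MeasurableSet[m] s) (f : Ω → ℝ) :
    ∫ ω in s, f ω ∂P = ∫ ω, f ω * s.indicator (fun _ => (1 : ℝ)) ω ∂P := by
  rw [← integral_indicator (hm s hs)]
  congr with ω
  by_cases h : ω ∈ s <;> simp [h]

lemma CondIndepGiven.symm (h : CondIndepGiven P m m₁ m₂) : CondIndepGiven P m m₂ m₁ := by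
  intro s t hs ht
  rw [Set.inter_comm, mul_comm]
  exact h t s ht hs

variable [IsProbabilityMeasure P]

lemma integrable_indicator_one (h : m ≤ mΩ) {s : Set Ω} (hs : MeasurableSet[m] s) :
    Integrable (s.indicator fun _ => (1 : ℝ)) P :=
  (integrable_const 1).indicator (h s hs)

lemma abs_indicator_one_le (s : Set Ω) (ω : Ω) : ‖s.indicator (fun _ => (1 : ℝ)) ω‖ ≤ 1 := by
  by_cases h : ω ∈ s <;> simp [h]

lemma stronglyMeasurable_indicator_one {s : Set Ω} (hs : MeasurableSet[m] s) :
    StronglyMeasurable[m] (s.indicator fun _ => (1 : ℝ)) :=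
  stronglyMeasurable_const.indicator hs

/-- `∫ f E[g | m] = ∫ E[f | m] E[g | m]` for `f` integrable and `g` bounded. -/
lemma integral_mul_condExp (hm : m ≤ mΩ) {f g : Ω → ℝ} (hf : Integrable f P)
    {C : ℝ} (hC : ∀ᵐ ω ∂P, ‖g ω‖ ≤ C) :
    ∫ ω, f ω * (P[g | m]) ω ∂P = ∫ ω, (P[f | m]) ω * (P[g | m]) ω ∂P := by
  have hfg : Integrable (f * P[g | m]) P :=
    hf.mul_bdd (stronglyMeasurable_condExp.mono hm).aestronglyMeasurable
      (ae_bdd_abs_condExp_of_ae_bdd_abs hC)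
  calc ∫ ω, f ω * (P[g | m]) ω ∂P = ∫ ω, (P[f * P[g | m] | m]) ω ∂P :=
        (integral_condExp hm).symm
    _ = _ := integral_congr_ae
        (condExp_mul_of_stronglyMeasurable_right stronglyMeasurable_condExp hfg hf)

namespace CondIndepGiven

/-- The sets a ∩ s with a in `m` and s in `m₁` form a π-system generating `m ⊔ m₁`. On such a set
both integrals reduce, after conditioning on `m`, to the product formula defining conditional
independence. -/
lemma condExp_indicator_sup (hm : m ≤ mΩ) (h₁ : m₁ ≤ mΩ) (h₂ : m₂ ≤ mΩ)
    (h : CondIndepGiven P m m₁ m₂) {t : Set Ω} (ht : MeasurableSet[m₂] t) :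
    P[t.indicator (fun _ => (1 : ℝ)) | m ⊔ m₁] =ᵐ[P] P[t.indicator (fun _ => (1 : ℝ)) | m] := by
  have hti := integrable_indicator_one (P := P) h₂ ht
  refine (ae_eq_condExp_of_forall_setIntegral_eq (sup_le hm h₁) hti
    (fun s _ _ => integrable_condExp.integrableOn) ?_
    (stronglyMeasurable_condExp.mono (le_sup_left : m ≤ m ⊔ m₁)).aestronglyMeasurable).symm
  intro u hu _
  refine setIntegral_eq_of_forall_inter hm h₁ integrable_condExp hti ?_ hu
  intro a s ha hs
  have hsi := integrable_indicator_one (P := P) h₁ hs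
  have hst := integrable_indicator_one (P := P) le_rfl ((h₁ s hs).inter (h₂ t ht))
  rw [← setIntegral_indicator (h₁ s hs), ← setIntegral_indicator (h₁ s hs)]
  have hleft : s.indicator (P[t.indicator (fun _ => (1 : ℝ)) | m]) =
      s.indicator (fun _ => (1 : ℝ)) * P[t.indicator (fun _ => (1 : ℝ)) | m] := by
    ext ω; by_cases hω : ω ∈ s <;> simp [hω]
  have hright : s.indicator (t.indicator fun _ => (1 : ℝ)) =
      (s ∩ t).indicator fun _ => (1 : ℝ) := by
    rw [Set.indicator_indicator]
  have hprod : Integrable (s.indicator (fun _ => (1 : ℝ)) *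
      P[t.indicator (fun _ => (1 : ℝ)) | m]) P :=
    integrable_condExp.bdd_mul hsi.aestronglyMeasurable
      (ae_of_all _ (abs_indicator_one_le s))
  rw [hleft, hright, ← setIntegral_condExp hm hprod ha, ← setIntegral_condExp hm hst ha]
  refine setIntegral_congr_ae (hm a ha) ?_
  filter_upwards [h s t hs ht, condExp_mul_of_stronglyMeasurable_right
    (stronglyMeasurable_condExp (m := m) (μ := P)) hprod hsi] with ω h1 h2 _
  rw [h1, h2]

/-- Project first onto `m ⊔ m₁`: the first indicator comes out, the second one is replaced by its
projection on `m`, and that comes out in the second projection. This lets the variables depend on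
the conditioning information too, as the losses do through `Z̄_t` and the random parameter. -/
lemma sup_left (hm : m ≤ mΩ) (h₁ : m₁ ≤ mΩ) (h₂ : m₂ ≤ mΩ)
    (h : CondIndepGiven P m m₁ m₂) : CondIndepGiven P m (m ⊔ m₁) m₂ := by
  intro s t hs ht
  have hle : m ⊔ m₁ ≤ mΩ := sup_le hm h₁
  have hsi := integrable_indicator_one (P := P) hle hs
  have hti := integrable_indicator_one (P := P) h₂ ht
  have heq : (s ∩ t).indicator (fun _ => (1 : ℝ)) =
      s.indicator (fun _ => (1 : ℝ)) * t.indicator fun _ => (1 : ℝ) := by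
    ext ω; by_cases h1 : ω ∈ s <;> by_cases h2 : ω ∈ t <;> simp [h1, h2]
  have hprod : Integrable (s.indicator (fun _ => (1 : ℝ)) *
      P[t.indicator (fun _ => (1 : ℝ)) | m]) P :=
    integrable_condExp.bdd_mul hsi.aestronglyMeasurable
      (ae_of_all _ (abs_indicator_one_le s))
  have hprod' : Integrable (s.indicator (fun _ => (1 : ℝ)) *
      t.indicator (fun _ => (1 : ℝ))) P :=
    hti.bdd_mul hsi.aestronglyMeasurable (ae_of_all _ (abs_indicator_one_le s))
  rw [heq]
  calc P[s.indicator (fun _ => (1 : ℝ)) * t.indicator (fun _ => (1 : ℝ)) | m]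
      =ᵐ[P] P[P[s.indicator (fun _ => (1 : ℝ)) * t.indicator (fun _ => (1 : ℝ)) | m ⊔ m₁] | m] :=
        (condExp_condExp_of_le le_sup_left hle).symm
    _ =ᵐ[P] P[s.indicator (fun _ => (1 : ℝ)) * P[t.indicator (fun _ => (1 : ℝ)) | m] | m] := by
        refine condExp_congr_ae ?_
        filter_upwards [h.condExp_indicator_sup hm h₁ h₂ ht,
          condExp_mul_of_stronglyMeasurable_left
            (stronglyMeasurable_indicator_one hs) hprod' hti] with ω h1 h2
        rw [h2, Pi.mul_apply, Pi.mul_apply, h1]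
    _ =ᵐ[P] _ := condExp_mul_of_stronglyMeasurable_right stronglyMeasurable_condExp hprod hsi

/-- Under conditional independence of `m₁` and `m₂` given `m`, conditioning an
`m ⊔ m₁`-measurable variable on `m ⊔ m₂` is the same as conditioning it on `m`. -/
lemma condExp_sup (hm : m ≤ mΩ) (h₁ : m₁ ≤ mΩ) (h₂ : m₂ ≤ mΩ)
    (h : CondIndepGiven P m m₁ m₂) {f : Ω → ℝ} (hf : StronglyMeasurable[m ⊔ m₁] f)
    (hfi : Integrable f P) : P[f | m ⊔ m₂] =ᵐ[P] P[f | m] := by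
  have hle₁ : m ⊔ m₁ ≤ mΩ := sup_le hm h₁
  have hle₂ : m ⊔ m₂ ≤ mΩ := sup_le hm h₂
  refine (ae_eq_condExp_of_forall_setIntegral_eq hle₂ hfi
    (fun s _ _ => integrable_condExp.integrableOn) ?_
    (stronglyMeasurable_condExp.mono (le_sup_left : m ≤ m ⊔ m₂)).aestronglyMeasurable).symm
  intro t ht _
  have hti := integrable_indicator_one (P := P) hle₂ ht
  have hbd : ∀ᵐ ω ∂P, ‖t.indicator (fun _ => (1 : ℝ)) ω‖ ≤ 1 :=
    ae_of_all _ (abs_indicator_one_le t)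
  have hind : CondIndepGiven P m m₁ (m ⊔ m₂) := (h.symm.sup_left hm h₂ h₁).symm
  have hft : Integrable (f * t.indicator fun _ => (1 : ℝ)) P :=
    hfi.mul_bdd hti.aestronglyMeasurable hbd
  have hft' : Integrable (P[f | m] * t.indicator fun _ => (1 : ℝ)) P :=
    integrable_condExp.mul_bdd hti.aestronglyMeasurable hbd
  rw [setIntegral_eq_integral_mul_indicator hle₂ ht,
    setIntegral_eq_integral_mul_indicator hle₂ ht]
  -- The projection onto `m` is moved from `f` to the indicator, replaced there by the projection
  -- onto `m ⊔ m₁` thanks to independence, and absorbed because `f` is `m ⊔ m₁`-measurable.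
  calc ∫ ω, (P[f | m]) ω * t.indicator (fun _ => (1 : ℝ)) ω ∂P
      = ∫ ω, (P[P[f | m] * t.indicator (fun _ => (1 : ℝ)) | m]) ω ∂P :=
        (integral_condExp hm).symm
    _ = ∫ ω, (P[f | m]) ω * (P[t.indicator (fun _ => (1 : ℝ)) | m]) ω ∂P :=
        integral_congr_ae
          (condExp_mul_of_stronglyMeasurable_left stronglyMeasurable_condExp hft' hti)
    _ = ∫ ω, f ω * (P[t.indicator (fun _ => (1 : ℝ)) | m]) ω ∂P :=
        (integral_mul_condExp hm hfi hbd).symm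
    _ = ∫ ω, f ω * (P[t.indicator (fun _ => (1 : ℝ)) | m ⊔ m₁]) ω ∂P := by
        refine integral_congr_ae ?_
        filter_upwards [hind.condExp_indicator_sup hm h₁ hle₂ ht] with ω hω
        rw [hω]
    _ = ∫ ω, (P[f * t.indicator (fun _ => (1 : ℝ)) | m ⊔ m₁]) ω ∂P :=
        (integral_congr_ae (condExp_mul_of_stronglyMeasurable_left hf hft hti)).symm
    _ = ∫ ω, f ω * t.indicator (fun _ => (1 : ℝ)) ω ∂P := integral_condExp hle₁

/-- Tower property through `m ⊔ m₂`: there `g` is known and `f` projects to its conditional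
expectation given `m`. -/
lemma condExp_mul (hm : m ≤ mΩ) (h₁ : m₁ ≤ mΩ) (h₂ : m₂ ≤ mΩ)
    (h : CondIndepGiven P m m₁ m₂) {f g : Ω → ℝ} (hf : StronglyMeasurable[m ⊔ m₁] f)
    (hg : StronglyMeasurable[m ⊔ m₂] g) (hfi : Integrable f P) (hgi : Integrable g P)
    {C : ℝ} (hC : ∀ᵐ ω ∂P, ‖g ω‖ ≤ C) :
    P[f * g | m] =ᵐ[P] P[f | m] * P[g | m] := by
  have hle₂ : m ⊔ m₂ ≤ mΩ := sup_le hm h₂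
  have hfg : Integrable (f * g) P := hfi.mul_bdd hgi.aestronglyMeasurable hC
  have hfg' : Integrable (P[f | m] * g) P :=
    integrable_condExp.mul_bdd hgi.aestronglyMeasurable hC
  calc P[f * g | m] =ᵐ[P] P[P[f * g | m ⊔ m₂] | m] :=
        (condExp_condExp_of_le le_sup_left hle₂).symm
    _ =ᵐ[P] P[P[f | m] * g | m] := by
        refine condExp_congr_ae ?_
        filter_upwards [h.condExp_sup hm h₁ h₂ hf hfi,
          condExp_mul_of_stronglyMeasurable_right hg hfg hfi] with ω h1 h2
        rw [h2, Pi.mul_apply, Pi.mul_apply, h1]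
    _ =ᵐ[P] _ := condExp_mul_of_stronglyMeasurable_left stronglyMeasurable_condExp hfg' hgi

end CondIndepGiven

/-- Conditional expectations of products of bounded variables over an independent set of a
conditional dependency graph factorize. -/
lemma condExp_prod_of_condIndepGiven {A : Type*} (hm : m ≤ mΩ) {ms : A → MeasurableSpace Ω}
    (hms : ∀ α, ms α ≤ mΩ) {G : SimpleGraph A}
    (hG : ∀ (α : A) (A' : Set A), α ∉ A' → (∀ α' ∈ A', ¬ G.Adj α α') →
      CondIndepGiven P m (ms α) (⨆ α' : A', ms α'))
    {f : A → Ω → ℝ} (hf : ∀ α, StronglyMeasurable[m ⊔ ms α] (f α)) {C : ℝ}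
    (hC : ∀ α, ∀ᵐ ω ∂P, ‖f α ω‖ ≤ C) (I : Finset A)
    (hI : ∀ α ∈ I, ∀ α' ∈ I, ¬ G.Adj α α') :
    P[∏ α ∈ I, f α | m] =ᵐ[P] ∏ α ∈ I, P[f α | m] := by
  classical
  induction I using Finset.induction_on with
  | empty =>
    simp only [Finset.prod_empty]
    exact (condExp_const hm (1 : ℝ)).eventuallyEq
  | insert a I ha ih =>
    have hsup : (⨆ α' : (I : Set A), ms α') ≤ mΩ := iSup_le fun α' => hms α'
    have hprod : StronglyMeasurable[m ⊔ ⨆ α' : (I : Set A), ms α'] (∏ α ∈ I, f α) :=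
      Finset.stronglyMeasurable_prod _ fun α hα =>
        (hf α).mono (sup_le_sup_left (le_iSup (fun α' : (I : Set A) => ms α') ⟨α, hα⟩) m)
    have hbound : ∀ᵐ ω ∂P, ‖(∏ α ∈ I, f α) ω‖ ≤ ∏ _α ∈ I, C := by
      have : ∀ᵐ ω ∂P, ∀ α ∈ I, ‖f α ω‖ ≤ C :=
        (Filter.eventually_all_finset I).2 fun α _ => hC α
      filter_upwards [this] with ω hω
      rw [Finset.prod_apply, norm_prod]
      exact Finset.prod_le_prod (fun _ _ => norm_nonneg _) hω
    have hfa : Integrable (f a) P :=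
      Integrable.of_bound ((hf a).mono (sup_le hm (hms a))).aestronglyMeasurable C (hC a)
    have hprodi : Integrable (∏ α ∈ I, f α) P :=
      Integrable.of_bound (hprod.mono (sup_le hm hsup)).aestronglyMeasurable _ hbound
    -- The new vertex is separated from all earlier ones jointly; pairwise independence would not
    -- make the product factorize.
    have hind := hG a I (by simpa using ha) fun α' hα' =>
      hI a (Finset.mem_insert_self _ _) α' (Finset.mem_insert_of_mem hα')
    rw [Finset.prod_insert ha, Finset.prod_insert ha]
    filter_upwards [hind.condExp_mul hm (hms a) hsup (hf a) hprod hfa hprodi hbound,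
      ih fun α hα α' hα' => hI α (Finset.mem_insert_of_mem hα) α' (Finset.mem_insert_of_mem hα')]
      with ω h1 h2
    rw [h1, Pi.mul_apply, Pi.mul_apply, h2]

end CondIndep

/-! ### Graph colouring. -/

/-- Greedy colouring: a finite graph can be coloured with `maxDegree + 1` colours. -/
lemma exists_coloring_maxDegree {A : Type*} [Fintype A] (G : SimpleGraph A) [DecidableRel G.Adj] :
    ∃ c : A → Fin (G.maxDegree + 1), ∀ a b, G.Adj a b → c a ≠ c b := by
  classical
  suffices ∀ s : Finset A, ∃ c : A → Fin (G.maxDegree + 1),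
      ∀ a ∈ s, ∀ b ∈ s, G.Adj a b → c a ≠ c b by
    obtain ⟨c, hc⟩ := this Finset.univ
    exact ⟨c, fun a b => hc a (Finset.mem_univ _) b (Finset.mem_univ _)⟩
  intro s
  induction s using Finset.induction_on with
  | empty => exact ⟨fun _ => 0, by simp⟩
  | insert a s ha ih =>
    obtain ⟨c, hc⟩ := ih
    -- The neighbours of `a` occupy at most `maxDegree` colours, so one of the `maxDegree + 1` is
    -- free.
    obtain ⟨k, hk⟩ : ∃ k, k ∉ (G.neighborFinset a).image c := by
      by_contra! h
      have h1 := Finset.card_image_le (s := G.neighborFinset a) (f := c)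
      rw [Finset.eq_univ_of_forall h, Finset.card_univ, Fintype.card_fin,
        G.card_neighborFinset_eq_degree] at h1
      have h2 := G.degree_le_maxDegree a
      omega
    have hk' : ∀ b, G.Adj a b → c b ≠ k := fun b hb hbk =>
      hk (Finset.mem_image.2 ⟨b, (G.mem_neighborFinset a b).2 hb, hbk⟩)
    refine ⟨Function.update c a k, ?_⟩
    intro x hx y hy hxy
    by_cases hxa : x = a
    · subst hxa
      rw [Function.update_self, Function.update_of_ne hxy.ne']
      exact (hk' y hxy).symm
    · by_cases hya : y = a
      · subst hya
        rw [Function.update_self, Function.update_of_ne hxa]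
        exact hk' x hxy.symm
      · rw [Function.update_of_ne hxa, Function.update_of_ne hya]
        exact hc x (Finset.mem_of_mem_insert_of_ne hx hxa) y
          (Finset.mem_of_mem_insert_of_ne hy hya) hxy

/-! ### Variance and Laplace transform of the average over one time slice. -/

section SliceBounds

/-- Jensen's inequality for weights `w i` at the points `y i / w i`, the missing mass being placed
at 0. It follows from the tangent line of exp at the barycentre `u`. Allowing total mass below 1
spares a normalization of the weights. -/
lemma exp_sum_le_sum_mul_exp {ι : Type*} (s : Finset ι) {w : ι → ℝ} (y : ι → ℝ)
    (hw : ∀ i ∈ s, 0 < w i) (hsum : ∑ i ∈ s, w i ≤ 1) :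
    Real.exp (∑ i ∈ s, y i) ≤
      ∑ i ∈ s, w i * Real.exp (y i / w i) + (1 - ∑ i ∈ s, w i) := by
  set u := ∑ i ∈ s, y i with hu
  have key : ∀ v : ℝ, Real.exp u * (1 + v - u) ≤ Real.exp v := fun v => by
    have h1 := Real.add_one_le_exp (v - u)
    calc Real.exp u * (1 + v - u) ≤ Real.exp u * Real.exp (v - u) := by gcongr; linarith
      _ = Real.exp v := by rw [← Real.exp_add]; congr 1; ring
  have h1 : ∑ i ∈ s, Real.exp u * (w i * (1 - u) + y i) ≤
      ∑ i ∈ s, w i * Real.exp (y i / w i) := by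
    refine Finset.sum_le_sum fun i hi => ?_
    have hwi := hw i hi
    calc Real.exp u * (w i * (1 - u) + y i)
        = w i * (Real.exp u * (1 + y i / w i - u)) := by field_simp; ring
      _ ≤ _ := by gcongr; exact key _
  rw [← Finset.mul_sum, Finset.sum_add_distrib, ← Finset.sum_mul, ← hu] at h1
  have h2 := mul_le_mul_of_nonneg_left (key 0) (sub_nonneg.2 hsum)
  rw [Real.exp_zero] at h2
  linarith

/-- The weight `1 / (2K) + √V_k / (2 ∑ √V_i)` of the `k`-th of `K` groups with variances `V`. -/
noncomputable def groupWeight {K : ℕ} (V : Fin K → ℝ) (k : Fin K) : ℝ :=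
  1 / (2 * (K : ℝ)) + √(V k) / (2 * ∑ i, √(V i))

section groupWeight

variable {K : ℕ} (V : Fin K → ℝ)

/-- The uniform half of the weight keeps the tilt r / (n w) bounded even for a class of tiny
variance. -/
lemma le_groupWeight (k : Fin K) : 1 / (2 * (K : ℝ)) ≤ groupWeight V k :=
  le_add_of_nonneg_right (by positivity)

lemma groupWeight_pos [NeZero K] (k : Fin K) : 0 < groupWeight V k := by
  have hK : (0 : ℝ) < K := by exact_mod_cast Nat.pos_of_neZero K
  exact lt_of_lt_of_le (by positivity) (le_groupWeight V k)

/-- Equality fails when all the square roots vanish: division by zero gives 0 and only the uniform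
half remains. -/
lemma sum_groupWeight_le_one [NeZero K] : ∑ k, groupWeight V k ≤ 1 := by
  have hK : (0 : ℝ) < K := by exact_mod_cast Nat.pos_of_neZero K
  unfold groupWeight
  rw [Finset.sum_add_distrib, ← Finset.sum_div (f := fun i => √(V i)),
    Finset.sum_const, Finset.card_univ,
    Fintype.card_fin, nsmul_eq_mul]
  have h1 : (K : ℝ) * (1 / (2 * K)) = 1 / 2 := by field_simp
  rw [h1]
  have h2 : (∑ i, √(V i)) / (2 * ∑ i, √(V i)) ≤ 1 / 2 := by
    rcases eq_or_ne (∑ i, √(V i)) 0 with h | h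
    · simp [h]
    · apply le_of_eq; field_simp
  linarith

/-- The variance-adapted half makes the ratio nearly equal across groups: w ≥ √V / (2T) with T = ∑
√V gives at most 4T², and T² is at most K ∑ V by Cauchy–Schwarz. -/
lemma div_groupWeight_sq_le [NeZero K] (hV : ∀ k, 0 ≤ V k) (k : Fin K) :
    V k / groupWeight V k ^ 2 ≤ 4 * K * ∑ i, V i := by
  have hw := groupWeight_pos V k
  set T := ∑ i, √(V i) with hT
  have hT0 : 0 ≤ T := Finset.sum_nonneg fun _ _ => Real.sqrt_nonneg _
  have hT2 : T ^ 2 ≤ K * ∑ i, V i := by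
    have := sq_sum_le_card_mul_sum_sq (s := (Finset.univ : Finset (Fin K)))
      (f := fun i => √(V i))
    simpa [Real.sq_sqrt (hV _)] using this
  have hs : √(V k) ≤ 2 * T * groupWeight V k := by
    rcases hT0.eq_or_lt with h | h
    · have : √(V k) = 0 :=
        (Finset.sum_eq_zero_iff_of_nonneg fun _ _ => Real.sqrt_nonneg _).1 (hT.symm.trans h.symm)
          k (Finset.mem_univ _)
      rw [this, ← h]; simp
    · have h1 : √(V k) / (2 * T) ≤ groupWeight V k := le_add_of_nonneg_left (by positivity)
      rw [div_le_iff₀ (by positivity)] at h1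
      linarith
  rw [div_le_iff₀ (by positivity), ← Real.sq_sqrt (hV k)]
  calc √(V k) ^ 2 ≤ (2 * T * groupWeight V k) ^ 2 := by gcongr
    _ = 4 * T ^ 2 * groupWeight V k ^ 2 := by ring
    _ ≤ 4 * (K * ∑ i, V i) * groupWeight V k ^ 2 := by gcongr
    _ = _ := by ring

lemma measurable_groupWeight {Ω : Type*} {_ : MeasurableSpace Ω} {V : Ω → Fin K → ℝ}
    (hV : ∀ k, Measurable fun ω => V ω k) (k : Fin K) :
    Measurable fun ω => groupWeight (V ω) k := by
  unfold groupWeight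
  fun_prop

end groupWeight

variable {Ω : Type*} {m : MeasurableSpace Ω} {mΩ : MeasurableSpace Ω} {P : Measure Ω}

/-- Since |μ Y| ≤ 1, exp(μ Y) ≤ 1 + μ Y + μ² Y². The linear term has conditional mean zero, and 1 +
z ≤ exp z closes the bound. The tilt `μ` may be random because it is `m`-measurable. -/
lemma condExp_exp_mul_le [IsProbabilityMeasure P] (hm : m ≤ mΩ) {Y μ : Ω → ℝ} {b M : ℝ}
    (hM : 0 ≤ M) (hMb : M * b ≤ 1)
    (hY : AEStronglyMeasurable Y P) (hYb : ∀ᵐ ω ∂P, |Y ω| ≤ b) (hY0 : P[Y | m] =ᵐ[P] 0)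
    (hμ : StronglyMeasurable[m] μ) (hμM : ∀ ω, |μ ω| ≤ M) :
    ∀ᵐ ω ∂P, (P[fun ω => Real.exp (μ ω * Y ω) | m]) ω ≤
      Real.exp (μ ω ^ 2 * (P[fun ω => Y ω ^ 2 | m]) ω) := by
  have hμ' : AEStronglyMeasurable μ P := (hμ.mono hm).aestronglyMeasurable
  have hu : ∀ᵐ ω ∂P, |μ ω * Y ω| ≤ 1 := by
    filter_upwards [hYb] with ω hω
    rw [abs_mul]
    exact (mul_le_mul (hμM ω) hω (abs_nonneg _) hM).trans hMb
  have hYi : Integrable Y P := Integrable.of_bound hY b hYb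
  have hY2i : Integrable (fun ω => Y ω ^ 2) P :=
    Integrable.of_bound (hY.pow 2) (b ^ 2) <| by
      filter_upwards [hYb] with ω hω
      rw [Real.norm_eq_abs, abs_pow]
      gcongr
  have hei : Integrable (fun ω => Real.exp (μ ω * Y ω)) P :=
    Integrable.of_bound (Real.continuous_exp.comp_aestronglyMeasurable (hμ'.mul hY))
      (Real.exp 1) <| by
      filter_upwards [hu] with ω hω
      rw [Real.norm_eq_abs, Real.abs_exp]
      exact Real.exp_le_exp.2 (le_of_abs_le hω)
  have h1 : Integrable (μ * Y) P := hYi.bdd_mul hμ' (ae_of_all _ hμM)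
  have h2 : Integrable ((fun ω => μ ω ^ 2) * fun ω => Y ω ^ 2) P :=
    hY2i.bdd_mul (c := M ^ 2) (hμ'.pow 2) <| ae_of_all _ fun ω => by
      rw [Real.norm_eq_abs, abs_pow]
      exact pow_le_pow_left₀ (abs_nonneg _) (hμM ω) 2
  have hmono : P[fun ω => Real.exp (μ ω * Y ω) | m] ≤ᵐ[P]
      P[(fun _ => (1 : ℝ)) + (μ * Y) + ((fun ω => μ ω ^ 2) * fun ω => Y ω ^ 2) | m] := by
    refine condExp_mono hei (((integrable_const 1).add h1).add h2) ?_
    filter_upwards [hu] with ω hω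
    have := le_of_abs_le (Real.abs_exp_sub_one_sub_id_le hω)
    simp only [Pi.add_apply, Pi.mul_apply]
    rw [mul_pow] at this
    linarith
  filter_upwards [hmono, condExp_add ((integrable_const 1).add h1) h2 m,
    condExp_add (integrable_const (1 : ℝ)) h1 m,
    condExp_mul_of_stronglyMeasurable_left hμ h1 hYi,
    condExp_mul_of_stronglyMeasurable_left (hμ.pow 2) h2 hY2i, hY0] with ω g1 g2 g3 g4 g5 g6
  refine g1.trans ?_
  rw [g2, Pi.add_apply, g3, Pi.add_apply, g4, Pi.mul_apply, g6, condExp_const hm]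
  erw [g5]
  simp only [Pi.zero_apply, mul_zero, add_zero, Pi.mul_apply, Pi.pow_apply]
  linarith [Real.add_one_le_exp (μ ω ^ 2 * (P[fun ω => Y ω ^ 2 | m]) ω)]

variable {A : Type*}

/-- The average over `α` of the conditional second moments of `Y α` given `m`. -/
noncomputable def avgCondSq [Fintype A] (P : Measure Ω) (m : MeasurableSpace Ω) (Y : A → Ω → ℝ)
    (ω : Ω) : ℝ :=
  1 / (Fintype.card A : ℝ) * ∑ α, (P[fun ω => Y α ω ^ 2 | m]) ω

lemma stronglyMeasurable_avgCondSq [Fintype A] (Y : A → Ω → ℝ) :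
    StronglyMeasurable[m] (avgCondSq P m Y) :=
  (Finset.stronglyMeasurable_fun_sum _ fun _ _ => stronglyMeasurable_condExp).const_mul _

lemma avgCondSq_nonneg [Fintype A] (Y : A → Ω → ℝ) : ∀ᵐ ω ∂P, 0 ≤ avgCondSq P m Y ω := by
  have : ∀ᵐ ω ∂P, ∀ α, 0 ≤ (P[fun ω => Y α ω ^ 2 | m]) ω :=
    ae_all_iff.2 fun α => condExp_nonneg (ae_of_all _ fun ω => sq_nonneg _)
  filter_upwards [this] with ω hω
  exact mul_nonneg (by positivity) (Finset.sum_nonneg fun α _ => hω α)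

/-- Centred bounded variables whose conditional dependencies given `m` are described by a graph. -/
structure IsCentredSlice (P : Measure Ω) (m : MeasurableSpace Ω) (ms : A → MeasurableSpace Ω)
    (G : SimpleGraph A) (b : ℝ) (Y : A → Ω → ℝ) : Prop where
  le : m ≤ mΩ
  le_loc : ∀ α, ms α ≤ mΩ
  condIndep : ∀ (α : A) (A' : Set A), α ∉ A' → (∀ α' ∈ A', ¬ G.Adj α α') →
      @CondIndepGiven Ω mΩ P m (ms α) (⨆ α' : A', ms α')
  meas : ∀ α, StronglyMeasurable[m ⊔ ms α] (Y α)
  bound : ∀ α, ∀ᵐ ω ∂P, |Y α ω| ≤ b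
  centred : ∀ α, P[Y α | m] =ᵐ[P] 0

namespace IsCentredSlice

variable {ms : A → MeasurableSpace Ω} {G : SimpleGraph A} {b : ℝ} {Y : A → Ω → ℝ}
  {K : ℕ} {c : A → Fin K}

lemma aestronglyMeasurable (h : IsCentredSlice P m ms G b Y) (α : A) :
    AEStronglyMeasurable (Y α) P :=
  ((h.meas α).mono (sup_le h.le (h.le_loc α))).aestronglyMeasurable

lemma integrable [IsProbabilityMeasure P] (h : IsCentredSlice P m ms G b Y) (α : A) :
    Integrable (Y α) P :=
  Integrable.of_bound (h.aestronglyMeasurable α) b (h.bound α)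

lemma integrable_mul [IsProbabilityMeasure P] (h : IsCentredSlice P m ms G b Y) (α α' : A) :
    Integrable (Y α * Y α') P :=
  (h.integrable α).mul_bdd (h.aestronglyMeasurable α') (h.bound α')

lemma condExp_mul_eq_zero [IsProbabilityMeasure P] (h : IsCentredSlice P m ms G b Y)
    {α α' : A} (hne : α ≠ α')
    (hadj : ¬ G.Adj α α') : P[Y α * Y α' | m] =ᵐ[P] 0 := by
  have hind := h.condIndep α {α'} (by simpa using hne) (by simpa using hadj)
  have hms : (⨆ x : ({α'} : Set A), ms x) = ms α' := by simp
  rw [hms] at hind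
  filter_upwards [hind.condExp_mul h.le (h.le_loc α) (h.le_loc α') (h.meas α) (h.meas α')
    (h.integrable α) (h.integrable α') (h.bound α'), h.centred α] with ω h1 h2
  rw [h1, Pi.mul_apply, h2]
  simp

variable [Fintype A]

/-- Cauchy–Schwarz over the K colours leaves only products within a colour class, and those off the
diagonal have zero conditional expectation. -/
lemma condExp_sq_avg_le [IsProbabilityMeasure P] (h : IsCentredSlice P m ms G b Y)
    (hc : ∀ α α', G.Adj α α' → c α ≠ c α') :
    ∀ᵐ ω ∂P, (P[fun ω => (1 / (Fintype.card A : ℝ) * ∑ α, Y α ω) ^ 2 | m]) ω ≤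
      K / (Fintype.card A : ℝ) * avgCondSq P m Y ω := by
  classical
  set n : ℝ := (Fintype.card A : ℝ) with hn
  -- Products masked to pairs of equal colour; their double sum equals the sum over colours of the
  -- squared class sums.
  let F : A → A → Ω → ℝ := fun α α' => if c α = c α' then Y α * Y α' else 0
  have hF : ∀ α α', Integrable (F α α') P := fun α α' => by
    by_cases hcc : c α = c α'
    · simpa [F, hcc] using h.integrable_mul α α'
    · simp [F, hcc]
  have hFc : ∀ α α', P[F α α' | m] =ᵐ[P]
      if α = α' then P[fun ω => Y α ω ^ 2 | m] else 0 := by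
    intro α α'
    by_cases heq : α = α'
    · subst heq
      have : Y α * Y α = fun ω => Y α ω ^ 2 := by ext ω; simp [sq]
      simp [F, this]
    · by_cases hcc : c α = c α'
      · simpa [F, hcc, heq] using h.condExp_mul_eq_zero heq fun hadj => hc α α' hadj hcc
      · simp [F, hcc, heq]
  have hsum : Integrable (∑ α, ∑ α', F α α') P :=
    integrable_finsetSum' _ fun α _ => integrable_finsetSum' _ fun α' _ => hF α α'
  have hpt : ∀ ω, (1 / n * ∑ α, Y α ω) ^ 2 ≤ ((K / n ^ 2) • ∑ α, ∑ α', F α α') ω := by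
    intro ω
    have h1 : ∑ α, Y α ω = ∑ k, ∑ α, if c α = k then Y α ω else 0 := by
      rw [Finset.sum_comm]; simp
    have h2 : ∀ α α', F α α' ω = ∑ k,
        (if c α = k then Y α ω else 0) * (if c α' = k then Y α' ω else 0) := by
      intro α α'
      by_cases hcc : c α = c α'
      · simp [F, hcc]
      · simp [F, hcc]
    have h3 : ∑ k, (∑ α, if c α = k then Y α ω else 0) ^ 2 = ∑ α, ∑ α', F α α' ω := by
      simp_rw [h2, sq, Finset.sum_mul_sum]
      rw [Finset.sum_comm]
      refine Finset.sum_congr rfl fun α _ => ?_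
      rw [Finset.sum_comm]
    have h4 := sq_sum_le_card_mul_sum_sq (s := (Finset.univ : Finset (Fin K)))
      (f := fun k => ∑ α, if c α = k then Y α ω else 0)
    rw [← h1, h3, Finset.card_univ, Fintype.card_fin] at h4
    simp only [Pi.smul_apply, Finset.sum_apply, smul_eq_mul]
    calc (1 / n * ∑ α, Y α ω) ^ 2 = (∑ α, Y α ω) ^ 2 / n ^ 2 := by ring
      _ ≤ (K * ∑ α, ∑ α', F α α' ω) / n ^ 2 := by gcongr
      _ = _ := by ring
  have hint : Integrable (fun ω => (1 / n * ∑ α, Y α ω) ^ 2) P := by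
    refine (hsum.smul (K / n ^ 2)).mono' ?_ (ae_of_all _ fun ω => ?_)
    · exact ((Finset.aestronglyMeasurable_fun_sum _ fun α _ =>
        h.aestronglyMeasurable α).const_mul _).pow 2
    · rw [Real.norm_eq_abs, abs_of_nonneg (sq_nonneg _)]
      exact hpt ω
  have hall : ∀ᵐ ω ∂P, ∀ α α', (P[F α α' | m]) ω =
      (if α = α' then P[fun ω => Y α ω ^ 2 | m] else 0) ω :=
    ae_all_iff.2 fun α => ae_all_iff.2 fun α' => hFc α α'
  have hin : ∀ᵐ ω ∂P, ∀ α, (P[∑ α', F α α' | m]) ω = ∑ α', (P[F α α' | m]) ω :=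
    ae_all_iff.2 fun α => by
      filter_upwards [condExp_finsetSum (fun α' _ => hF α α') m (s := Finset.univ)] with ω hω
      rw [hω, Finset.sum_apply]
  filter_upwards [condExp_mono hint (hsum.smul _) (ae_of_all _ hpt),
    condExp_smul (μ := P) (K / n ^ 2) (∑ α, ∑ α', F α α') m,
    condExp_finsetSum (fun α _ => integrable_finsetSum' _ fun α' _ => hF α α') m
      (s := Finset.univ) (f := fun α => ∑ α', F α α'),
    hall, hin] with ω g1 g2 g3 g4 g5
  refine g1.trans (le_of_eq ?_)
  rw [g2, Pi.smul_apply, g3, Finset.sum_apply]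
  simp only [g5, g4, smul_eq_mul]
  have : ∀ α, ∑ α', (if α = α' then P[fun ω => Y α ω ^ 2 | m] else 0) ω =
      (P[fun ω => Y α ω ^ 2 | m]) ω := by
    intro α
    rw [Finset.sum_eq_single α] <;> simp +contextual [eq_comm]
  simp only [this, avgCondSq, ← hn]
  ring

/-- The conditional Laplace transform of the average of a centred slice over a graph that can be
coloured with `K` colours. -/
lemma condExp_exp_avg_le [IsProbabilityMeasure P] [NeZero K] [Nonempty A]
    (h : IsCentredSlice P m ms G b Y)
    (hc : ∀ α α', G.Adj α α' → c α ≠ c α') {r : ℝ}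
    (hr : 2 * |r| * (K / (Fintype.card A : ℝ)) * b ≤ 1) :
    ∀ᵐ ω ∂P, (P[fun ω => Real.exp (r * (1 / (Fintype.card A : ℝ) * ∑ α, Y α ω)) | m]) ω ≤
      Real.exp (4 * r ^ 2 * (K / (Fintype.card A : ℝ)) * avgCondSq P m Y ω) := by
  classical
  set n : ℝ := (Fintype.card A : ℝ) with hn
  have hn0 : 0 < n := by rw [hn]; exact_mod_cast Fintype.card_pos
  have hK : (0 : ℝ) < K := by exact_mod_cast Nat.pos_of_neZero K
  let σ2 : A → Ω → ℝ := fun α => P[fun ω => Y α ω ^ 2 | m]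
  let I : Fin K → Finset A := fun k => Finset.univ.filter fun α => c α = k
  -- The class variances are conditional on `m`, so weights and tilts are random but `m`-measurable,
  -- and can be treated as constants under conditioning.
  let V : Ω → Fin K → ℝ := fun ω k => ∑ α ∈ I k, σ2 α ω
  let w : Fin K → Ω → ℝ := fun k ω => groupWeight (V ω) k
  let μ : Fin K → Ω → ℝ := fun k ω => r / n / w k ω
  let f : Fin K → A → Ω → ℝ := fun k α ω => Real.exp (μ k ω * Y α ω)
  have hwpos : ∀ k ω, 0 < w k ω := fun k ω => groupWeight_pos _ _
  have hVm : ∀ k, Measurable[m] fun ω => V ω k := fun k =>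
    (Finset.stronglyMeasurable_fun_sum _ fun α _ => stronglyMeasurable_condExp).measurable
  have hwm : ∀ k, Measurable[m] (w k) := fun k => measurable_groupWeight hVm k
  have hμm : ∀ k, Measurable[m] (μ k) := fun k => (hwm k).const_div _
  have hw1 : ∀ k ω, ‖w k ω‖ ≤ 1 := fun k ω => by
    rw [Real.norm_eq_abs, abs_of_pos (hwpos k ω)]
    exact (Finset.single_le_sum (f := fun k => groupWeight (V ω) k)
      (fun i _ => (groupWeight_pos _ i).le) (Finset.mem_univ k)).trans (sum_groupWeight_le_one _)
  -- From w ≥ 1 / (2K) every tilt is at most `M`, and `hr` says precisely M b ≤ 1, the range where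
  -- the quadratic bound on exp applies.
  set M : ℝ := 2 * |r| * (K / n) with hMdef
  have hM0 : 0 ≤ M := by positivity
  have hμM : ∀ k ω, |μ k ω| ≤ M := fun k ω => by
    have h1 : 1 / (2 * (K : ℝ)) ≤ w k ω := le_groupWeight _ _
    simp only [μ]
    rw [abs_div, abs_div, abs_of_pos hn0, abs_of_pos (hwpos k ω), div_le_iff₀ (hwpos k ω)]
    calc |r| / n = M * (1 / (2 * K)) := by rw [hMdef]; field_simp
      _ ≤ M * w k ω := by gcongr
  have hfm : ∀ k α, StronglyMeasurable[m ⊔ ms α] (f k α) := fun k α =>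
    Real.continuous_exp.comp_stronglyMeasurable
      (((hμm k).stronglyMeasurable.mono (le_sup_left : m ≤ m ⊔ ms α)).mul (h.meas α))
  have hfb : ∀ k α, ∀ᵐ ω ∂P, ‖f k α ω‖ ≤ Real.exp 1 := fun k α => by
    filter_upwards [h.bound α] with ω hω
    rw [Real.norm_eq_abs, Real.abs_exp]
    refine Real.exp_le_exp.2 ((le_abs_self _).trans ?_)
    rw [abs_mul]
    exact (mul_le_mul (hμM k ω) hω (abs_nonneg _) hM0).trans hr
  let g : Fin K → Ω → ℝ := fun k => ∏ α ∈ I k, f k α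
  have hgi : ∀ k, Integrable (g k) P := fun k => by
    refine Integrable.of_bound (C := ∏ _α ∈ I k, Real.exp 1)
      (Finset.aestronglyMeasurable_prod _ fun α _ =>
        ((hfm k α).mono (sup_le h.le (h.le_loc α))).aestronglyMeasurable) ?_
    filter_upwards [(Filter.eventually_all_finset (I k)).2 fun α _ => hfb k α] with ω hω
    simp only [g, Finset.prod_apply, norm_prod]
    exact Finset.prod_le_prod (fun _ _ => norm_nonneg _) hω
  have hwgi : ∀ k, Integrable (w k * g k) P := fun k =>
    (hgi k).bdd_mul ((hwm k).stronglyMeasurable.mono h.le).aestronglyMeasurable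
      (ae_of_all _ (hw1 k))
  have hrest_m : StronglyMeasurable[m] fun ω => 1 - ∑ k, w k ω :=
    stronglyMeasurable_const.sub
      (Finset.stronglyMeasurable_fun_sum _ fun k _ => (hwm k).stronglyMeasurable)
  have hrest_i : Integrable (fun ω => 1 - ∑ k, w k ω) P :=
    (integrable_const _).sub (integrable_finsetSum _ fun k _ =>
      Integrable.of_bound ((hwm k).stronglyMeasurable.mono h.le).aestronglyMeasurable 1
        (ae_of_all _ (hw1 k)))
  have hsumi : Integrable (∑ k, w k * g k) P := integrable_finsetSum' _ fun k _ => hwgi k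
  have hpt : ∀ ω, Real.exp (r * (1 / n * ∑ α, Y α ω)) ≤
      ((∑ k, w k * g k) + fun ω => 1 - ∑ k, w k ω) ω := by
    intro ω
    have h1 : r * (1 / n * ∑ α, Y α ω) = ∑ k, r / n * ∑ α ∈ I k, Y α ω := by
      rw [← Finset.mul_sum, Finset.sum_fiberwise]; ring
    rw [h1]
    refine (exp_sum_le_sum_mul_exp Finset.univ _ (fun k _ => hwpos k ω)
      (sum_groupWeight_le_one _)).trans (le_of_eq ?_)
    simp only [Pi.add_apply, Finset.sum_apply, Pi.mul_apply, g, f, Finset.prod_apply]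
    congr 1
    refine Finset.sum_congr rfl fun k _ => ?_
    rw [← Real.exp_sum, ← Finset.mul_sum]
    congr 2
    simp only [μ]
    ring
  have hexpi : Integrable (fun ω => Real.exp (r * (1 / n * ∑ α, Y α ω))) P := by
    refine (hsumi.add hrest_i).mono' ?_ (ae_of_all _ fun ω => ?_)
    · exact Real.continuous_exp.comp_aestronglyMeasurable
        (((Finset.aestronglyMeasurable_fun_sum _ fun α _ =>
          h.aestronglyMeasurable α).const_mul _).const_mul _)
    · rw [Real.norm_eq_abs, Real.abs_exp]
      exact hpt ω
  have hprod : ∀ᵐ ω ∂P, ∀ k, (P[g k | m]) ω = ∏ α ∈ I k, (P[f k α | m]) ω :=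
    ae_all_iff.2 fun k => by
      -- A colour class contains no edge, so its product of exponentials factorizes conditionally.
      filter_upwards [condExp_prod_of_condIndepGiven h.le h.le_loc h.condIndep (hfm k) (hfb k)
        (I k) fun α hα α' hα' hadj => hc α α' hadj <| by
          rw [(Finset.mem_filter.1 hα).2, (Finset.mem_filter.1 hα').2]] with ω hω
      rw [hω, Finset.prod_apply]
  have hpull : ∀ᵐ ω ∂P, ∀ k, (P[w k * g k | m]) ω = w k ω * (P[g k | m]) ω :=
    ae_all_iff.2 fun k => condExp_mul_of_stronglyMeasurable_left (hwm k).stronglyMeasurable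
      (hwgi k) (hgi k)
  have hfle : ∀ᵐ ω ∂P, ∀ k α, 0 ≤ (P[f k α | m]) ω ∧
      (P[f k α | m]) ω ≤ Real.exp (μ k ω ^ 2 * σ2 α ω) :=
    ae_all_iff.2 fun k => ae_all_iff.2 fun α =>
      (condExp_nonneg (ae_of_all _ fun ω => (Real.exp_pos _).le)).and
        (condExp_exp_mul_le h.le hM0 hr (h.aestronglyMeasurable α) (h.bound α) (h.centred α)
          (hμm k).stronglyMeasurable (hμM k))
  have hσ : ∀ᵐ ω ∂P, ∀ α, 0 ≤ σ2 α ω :=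
    ae_all_iff.2 fun α => condExp_nonneg (ae_of_all _ fun ω => sq_nonneg _)
  filter_upwards [condExp_mono hexpi (hsumi.add hrest_i) (ae_of_all _ hpt),
    condExp_add hsumi hrest_i m, condExp_finsetSum (fun k _ => hwgi k) m (s := Finset.univ),
    hprod, hpull, hfle, hσ] with ω g1 g2 g3 g4 g5 g6 g7
  refine g1.trans ?_
  rw [g2, Pi.add_apply, g3, Finset.sum_apply, condExp_of_stronglyMeasurable h.le hrest_m hrest_i]
  simp only [g5, g4]
  set E := Real.exp (4 * r ^ 2 * (K / n) * avgCondSq P m Y ω) with hE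
  have hV0 : ∀ k, 0 ≤ V ω k := fun k => Finset.sum_nonneg fun α _ => g7 α
  have hVsum : ∑ k, V ω k = n * avgCondSq P m Y ω := by
    simp only [V, I, avgCondSq, ← hn]
    rw [Finset.sum_fiberwise]
    field_simp
    rfl
  have hE1 : 1 ≤ E := Real.one_le_exp <| by
    have : 0 ≤ avgCondSq P m Y ω := mul_nonneg (by positivity) (Finset.sum_nonneg fun α _ => g7 α)
    positivity
  have hkE : ∀ k, ∏ α ∈ I k, (P[f k α | m]) ω ≤ E := by
    intro k
    calc ∏ α ∈ I k, (P[f k α | m]) ω ≤ ∏ α ∈ I k, Real.exp (μ k ω ^ 2 * σ2 α ω) :=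
          Finset.prod_le_prod (fun α _ => (g6 k α).1) fun α _ => (g6 k α).2
      _ = Real.exp (μ k ω ^ 2 * V ω k) := by rw [← Real.exp_sum, ← Finset.mul_sum]
      _ ≤ E := by
          refine Real.exp_le_exp.2 ?_
          calc μ k ω ^ 2 * V ω k = (r / n) ^ 2 * (V ω k / groupWeight (V ω) k ^ 2) := by
                simp only [μ, w]; rw [div_pow]; ring
            _ ≤ (r / n) ^ 2 * (4 * K * ∑ i, V ω i) := by
                gcongr; exact div_groupWeight_sq_le _ hV0 k
            _ = _ := by rw [hVsum]; field_simp
  -- All classes obey the same bound `E`, and the leftover mass does too because E ≥ 1.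
  calc ∑ k, w k ω * ∏ α ∈ I k, (P[f k α | m]) ω + (1 - ∑ k, w k ω)
      ≤ ∑ k, w k ω * E + (1 - ∑ k, w k ω) * E := by
        refine add_le_add (Finset.sum_le_sum fun k _ =>
          mul_le_mul_of_nonneg_left (hkE k) (hwpos k ω).le) ?_
        exact le_mul_of_one_le_right (sub_nonneg.2 (sum_groupWeight_le_one _)) hE1
    _ = E := by rw [← Finset.sum_mul]; ring

end IsCentredSlice

end SliceBounds

/-! ### Exponential supermartingale in time. -/

/-- A Freedman-type tail bound: `ℱ` is the past, `H τ` the information available just before the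
increment `D τ` is revealed, and the conditional Laplace transforms of the increments are
controlled by the predictable process `v`. -/
lemma measureReal_le_exp_neg_of_condExp_exp_le {Ω : Type*} {mΩ : MeasurableSpace Ω}
    {P : Measure Ω} [IsProbabilityMeasure P] {ℱ H : ℕ → MeasurableSpace Ω}
    (hℱ : ∀ τ, ℱ τ ≤ mΩ) (hℱH : ∀ τ, ℱ τ ≤ H (τ + 1)) (hHℱ : ∀ τ, 1 ≤ τ → H τ ≤ ℱ τ)
    {D v : ℕ → Ω → ℝ} {b r κ : ℝ}
    (hD : ∀ τ, 1 ≤ τ → StronglyMeasurable[ℱ τ] (D τ))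
    (hv : ∀ τ, 1 ≤ τ → StronglyMeasurable[H τ] (v τ))
    (hDb : ∀ τ, 1 ≤ τ → ∀ᵐ ω ∂P, |D τ ω| ≤ b)
    (hv0 : ∀ τ, 1 ≤ τ → ∀ᵐ ω ∂P, 0 ≤ v τ ω) (hκ : 0 ≤ κ)
    (hexp : ∀ τ, 1 ≤ τ → ∀ᵐ ω ∂P, (P[fun ω => Real.exp (r * D τ ω) | H τ]) ω ≤
      Real.exp (κ * v τ ω))
    (t : ℕ) {a : ℝ} {s : Set Ω}
    (hs : ∀ᵐ ω ∂P, ω ∈ s → a ≤ ∑ τ ∈ Finset.Icc 1 t, (r * D τ ω - κ * v τ ω)) :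
    P.real s ≤ Real.exp (-a) := by
  let L : ℕ → Ω → ℝ := fun k ω => Real.exp (∑ τ ∈ Finset.Icc 1 k, (r * D τ ω - κ * v τ ω))
  have hℱmono : Monotone ℱ :=
    monotone_nat_of_le_succ fun k => (hℱH k).trans (hHℱ (k + 1) (by omega))
  have hLm : ∀ k, StronglyMeasurable[ℱ k] (L k) := fun k =>
    Real.continuous_exp.comp_stronglyMeasurable <|
      Finset.stronglyMeasurable_fun_sum _ fun τ hτ => by
        obtain ⟨h1, h2⟩ := Finset.mem_Icc.1 hτ
        exact (((hD τ h1).mono (hℱmono h2)).const_mul r).sub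
          (((hv τ h1).mono ((hHℱ τ h1).trans (hℱmono h2))).const_mul κ)
  have hinc : ∀ τ, 1 ≤ τ → ∀ᵐ ω ∂P, r * D τ ω - κ * v τ ω ≤ |r| * b := fun τ h1 => by
    filter_upwards [hDb τ h1, hv0 τ h1] with ω g1 g2
    have h3 : r * D τ ω ≤ |r| * b := by
      refine (le_abs_self _).trans ?_
      rw [abs_mul]
      gcongr
    have h4 := mul_nonneg hκ g2
    linarith
  have hLb : ∀ k, ∀ᵐ ω ∂P, ‖L k ω‖ ≤ Real.exp (∑ _τ ∈ Finset.Icc 1 k, |r| * b) := fun k => by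
    filter_upwards [(Filter.eventually_all_finset (Finset.Icc 1 k)).2 fun τ hτ =>
      hinc τ (Finset.mem_Icc.1 hτ).1] with ω hω
    rw [Real.norm_eq_abs, Real.abs_exp]
    exact Real.exp_le_exp.2 (Finset.sum_le_sum hω)
  have hLi : ∀ k, Integrable (L k) P := fun k =>
    Integrable.of_bound ((hLm k).mono (hℱ k)).aestronglyMeasurable _ (hLb k)
  have hL1 : ∀ k, ∫ ω, L k ω ∂P ≤ 1 := by
    intro k
    induction k with
    | zero => simp [L]
    | succ k ih =>
      have h1 : 1 ≤ k + 1 := by omega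
      have hH : H (k + 1) ≤ mΩ := (hHℱ _ h1).trans (hℱ _)
      -- The compensator of step k + 1 is already known to `H (k + 1)`, so it joins the past factor;
      -- only the exponential of the new increment gets averaged.
      let g : Ω → ℝ := fun ω => L k ω * Real.exp (-(κ * v (k + 1) ω))
      let e : Ω → ℝ := fun ω => Real.exp (r * D (k + 1) ω)
      have hge : L (k + 1) = g * e := by
        ext ω
        simp only [L, g, e, Pi.mul_apply]
        rw [Finset.sum_Icc_succ_top h1, ← Real.exp_add, ← Real.exp_add]
        congr 1
        ring
      have hgm : StronglyMeasurable[H (k + 1)] g :=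
        ((hLm k).mono (hℱH k)).mul (Real.continuous_exp.comp_stronglyMeasurable
          ((hv _ h1).const_mul κ).neg)
      have hei : Integrable e P := by
        refine Integrable.of_bound (C := Real.exp (|r| * b))
          (Real.continuous_exp.comp_aestronglyMeasurable
            (((hD _ h1).mono (hℱ _)).aestronglyMeasurable.const_mul r)) ?_
        filter_upwards [hDb _ h1] with ω hω
        rw [Real.norm_eq_abs, Real.abs_exp]
        refine Real.exp_le_exp.2 ((le_abs_self _).trans ?_)
        rw [abs_mul]
        gcongr
      have hgei : Integrable (g * e) P := hge ▸ hLi (k + 1)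
      calc ∫ ω, L (k + 1) ω ∂P = ∫ ω, (P[g * e | H (k + 1)]) ω ∂P := by
            rw [integral_condExp hH, hge]
        _ ≤ ∫ ω, L k ω ∂P := by
            refine integral_mono_ae integrable_condExp (hLi k) ?_
            filter_upwards [condExp_mul_of_stronglyMeasurable_left hgm hgei hei, hexp _ h1]
              with ω g1 g2
            rw [g1, Pi.mul_apply]
            calc g ω * (P[e | H (k + 1)]) ω ≤ g ω * Real.exp (κ * v (k + 1) ω) :=
                  mul_le_mul_of_nonneg_left g2
                    (mul_nonneg (Real.exp_pos _).le (Real.exp_pos _).le)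
              _ = L k ω := by
                  simp only [g]
                  rw [mul_assoc, ← Real.exp_add, neg_add_cancel, Real.exp_zero, mul_one]
        _ ≤ 1 := ih
  have hmarkov := mul_meas_ge_le_integral_of_nonneg (μ := P) (f := L t)
    (ae_of_all _ fun ω => (Real.exp_pos _).le) (hLi t) (Real.exp a)
  have hsub : P.real s ≤ P.real {ω | Real.exp a ≤ L t ω} := by
    refine ENNReal.toReal_mono (measure_ne_top _ _) (measure_mono_ae ?_)
    filter_upwards [hs] with ω hω hωs
    exact Real.exp_le_exp.2 (hω hωs)
  rw [Real.exp_neg, ← one_div, le_div_iff₀ (Real.exp_pos a), mul_comm]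
  exact (mul_le_mul_of_nonneg_left hsub (Real.exp_pos a).le).trans (hmarkov.trans (hL1 t))

/-! ### The σ-fields of past, summaries and observations. -/

section Measurability

variable {Ω A O Z Θ : Type*} [MeasurableSpace O] [MeasurableSpace Z]

lemma past_mono (obs : ℕ → Ω → A → O) : Monotone (past obs) := fun _ _ h =>
  biSup_mono fun _ hτ => Finset.Icc_subset_Icc_right h hτ

lemma past_le {mΩ : MeasurableSpace Ω} {obs : ℕ → Ω → A → O} (h_obs : ∀ t, Measurable (obs t))
    (t : ℕ) : past obs t ≤ mΩ :=
  iSup₂_le fun τ _ => (h_obs τ).comap_le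

lemma comap_obs_le_past (obs : ℕ → Ω → A → O) {t : ℕ} (ht : 1 ≤ t) :
    MeasurableSpace.comap (obs t) inferInstance ≤ past obs t :=
  le_iSup₂_of_le t (Finset.mem_Icc.2 ⟨ht, le_rfl⟩) le_rfl

lemma comap_obs_apply_le (obs : ℕ → Ω → A → O) (α : A) (t : ℕ) :
    MeasurableSpace.comap (fun ω => obs t ω α) inferInstance ≤
      MeasurableSpace.comap (obs t) inferInstance := by
  have : (fun ω => obs t ω α) = (fun f : A → O => f α) ∘ obs t := rfl
  rw [this, ← MeasurableSpace.comap_comp]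
  exact MeasurableSpace.comap_mono (measurable_pi_apply α).comap_le

lemma past_le_jointInfo (S : (A → O) → A → Z) (obs : ℕ → Ω → A → O) (t : ℕ) :
    past obs (t - 1) ≤ jointInfo S obs t := le_sup_right

lemma jointInfo_le_past {S : (A → O) → A → Z} (h_S : Measurable S) (obs : ℕ → Ω → A → O)
    {t : ℕ} (ht : 1 ≤ t) : jointInfo S obs t ≤ past obs t := by
  refine sup_le ?_ (past_mono obs (Nat.sub_le t 1))
  refine le_trans ?_ (comap_obs_le_past obs ht)
  have : (fun ω α => summ S obs α t ω) = S ∘ obs t := rfl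
  rw [this, ← MeasurableSpace.comap_comp]
  exact MeasurableSpace.comap_mono h_S.comap_le

lemma measurable_summ_jointInfo (S : (A → O) → A → Z) (obs : ℕ → Ω → A → O) (α : A) (t : ℕ) :
    Measurable[jointInfo S obs t] (summ S obs α t) := by
  have h : Measurable[jointInfo S obs t] fun ω α => summ S obs α t ω :=
    (comap_measurable _).mono le_sup_left le_rfl
  exact (measurable_pi_apply α).comp h

lemma localInfo_le_jointInfo (S : (A → O) → A → Z) (obs : ℕ → Ω → A → O) (α : A) (t : ℕ) :
    localInfo S obs α t ≤ jointInfo S obs t :=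
  sup_le (measurable_summ_jointInfo S obs α t).comap_le (past_le_jointInfo S obs t)

variable [MeasurableSpace Θ] {loss : Θ → O → Z → ℝ} {S : (A → O) → A → Z}
  {obs : ℕ → Ω → A → O}

lemma measurable_lossAt (h_loss : Measurable fun p : Θ × O × Z => loss p.1 p.2.1 p.2.2)
    {η : Ω → Θ} {t : ℕ} (hη : Measurable[past obs (t - 1)] η) (α : A) :
    Measurable[jointInfo S obs t ⊔ MeasurableSpace.comap (fun ω => obs t ω α) inferInstance]
      (lossAt loss S obs η α t) := by
  have h1 := hη.mono ((past_le_jointInfo S obs t).trans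
    (le_sup_left (b := MeasurableSpace.comap (fun ω => obs t ω α) inferInstance))) le_rfl
  have h2 : Measurable[jointInfo S obs t ⊔
      MeasurableSpace.comap (fun ω => obs t ω α) inferInstance] fun ω => obs t ω α :=
    (comap_measurable _).mono le_sup_right le_rfl
  have h3 := (measurable_summ_jointInfo S obs α t).mono
    (le_sup_left (b := MeasurableSpace.comap (fun ω => obs t ω α) inferInstance)) le_rfl
  exact h_loss.comp (h1.prodMk (h2.prodMk h3))

lemma measurable_diffAt (h_loss : Measurable fun p : Θ × O × Z => loss p.1 p.2.1 p.2.2)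
    (θ₀ : Θ) {η : Ω → Θ} {t : ℕ} (hη : Measurable[past obs (t - 1)] η) (α : A) :
    Measurable[jointInfo S obs t ⊔ MeasurableSpace.comap (fun ω => obs t ω α) inferInstance]
      (diffAt loss S obs θ₀ η α t) :=
  (measurable_lossAt h_loss hη α).sub (measurable_lossAt h_loss measurable_const α)

lemma jointInfo_sup_comap_le_past (h_S : Measurable S) {t : ℕ} (ht : 1 ≤ t) (α : A) :
    jointInfo S obs t ⊔ MeasurableSpace.comap (fun ω => obs t ω α) inferInstance ≤ past obs t :=
  sup_le (jointInfo_le_past h_S obs ht)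
    ((comap_obs_apply_le obs α t).trans (comap_obs_le_past obs ht))

/-- Brings the joint σ-field in the dependency graph assumption to the supremum form used for
slices. -/
lemma comap_restrict_eq_iSup (obs : ℕ → Ω → A → O) (t : ℕ) (A' : Set A) :
    MeasurableSpace.comap (fun ω (α' : A') => obs t ω α') inferInstance =
      ⨆ α' : A', MeasurableSpace.comap (fun ω => obs t ω α') inferInstance := by
  change MeasurableSpace.comap _ (⨆ a, MeasurableSpace.comap _ _) = _
  rw [MeasurableSpace.comap_iSup]
  simp_rw [MeasurableSpace.comap_comp]
  rfl

end Measurability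

lemma avgDiff_eq {Ω A O Z Θ : Type*} [Fintype A] (loss : Θ → O → Z → ℝ) (S : (A → O) → A → Z)
    (obs : ℕ → Ω → A → O) (θ₀ : Θ) (η : Ω → Θ) (t : ℕ) (ω : Ω) :
    avgDiff loss S obs θ₀ η t ω =
      1 / (Fintype.card A : ℝ) * ∑ α, diffAt loss S obs θ₀ η α t ω := by
  simp only [avgDiff, avgLoss, diffAt, Finset.sum_sub_distrib]
  ring

/-! ### Centred loss differences form a centred slice. -/

section Slice

variable {Ω A O Z Θ : Type*} {mΩ : MeasurableSpace Ω} [MeasurableSpace O] [MeasurableSpace Z]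
  {P : Measure Ω} {obs : ℕ → Ω → A → O}
  {S : (A → O) → A → Z} {loss : Θ → O → Z → ℝ} {θ₀ : Θ} {b₁ b₂ : ℝ} {η : Ω → Θ} {t : ℕ}

/-- The loss differences centred by their conditional expectations given `Z̄_t` and `F_{t-1}`. -/
noncomputable def centredDiff (P : Measure Ω) (loss : Θ → O → Z → ℝ) (S : (A → O) → A → Z)
    (obs : ℕ → Ω → A → O) (θ₀ : Θ) (η : Ω → Θ) (t : ℕ) (α : A) (ω : Ω) : ℝ :=
  diffAt loss S obs θ₀ η α t ω - (P[diffAt loss S obs θ₀ η α t | jointInfo S obs t]) ω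

variable [MeasurableSpace Θ] [IsProbabilityMeasure P]

lemma memLp_diffAt (h_obs : ∀ t, Measurable (obs t)) (h_S : Measurable S)
    (h_loss : Measurable fun p : Θ × O × Z => loss p.1 p.2.1 p.2.2)
    (h_bdd : Boundedness P loss S obs θ₀ b₁ b₂) (ht : 1 ≤ t)
    (hη : Measurable[past obs (t - 1)] η) (α : A) :
    MemLp (diffAt loss S obs θ₀ η α t) 2 P :=
  MemLp.of_bound ((measurable_diffAt h_loss θ₀ hη α).mono
    ((jointInfo_sup_comap_le_past h_S ht α).trans (past_le h_obs t)) le_rfl).aestronglyMeasurable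
    b₁ (ae_of_all _ fun _ => h_bdd.2.1 _ _ _)

/-- Square integrability is assumed for constant parameters only; a random one differs from `θ₀` by
a bounded loss difference. -/
lemma memLp_lossAt (h_obs : ∀ t, Measurable (obs t)) (h_S : Measurable S)
    (h_loss : Measurable fun p : Θ × O × Z => loss p.1 p.2.1 p.2.2)
    (h_sq : ∀ (θ : Θ) (α : A) (t : ℕ), 1 ≤ t → MemLp (lossAt loss S obs (fun _ => θ) α t) 2 P)
    (h_bdd : Boundedness P loss S obs θ₀ b₁ b₂) (ht : 1 ≤ t)
    (hη : Measurable[past obs (t - 1)] η) (α : A) :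
    MemLp (lossAt loss S obs η α t) 2 P := by
  have h := (memLp_diffAt h_obs h_S h_loss h_bdd ht hη α).add (h_sq θ₀ α t ht)
  have heq : diffAt loss S obs θ₀ η α t + lossAt loss S obs (fun _ => θ₀) α t =
      lossAt loss S obs η α t := by
    ext ω; simp [diffAt]
  rwa [heq] at h

variable [Fintype A]

lemma condExp_diffAt_jointInfo (h_obs : ∀ t, Measurable (obs t)) (h_S : Measurable S)
    (h_loss : Measurable fun p : Θ × O × Z => loss p.1 p.2.1 p.2.2)
    (h_sq : ∀ (θ : Θ) (α : A) (t : ℕ), 1 ≤ t → MemLp (lossAt loss S obs (fun _ => θ) α t) 2 P)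
    (h_stat : Stationarity P loss S obs) (h_bdd : Boundedness P loss S obs θ₀ b₁ b₂)
    (ht : 1 ≤ t) (hη : Measurable[past obs (t - 1)] η) (α : A) :
    P[diffAt loss S obs θ₀ η α t | jointInfo S obs t] =ᵐ[P]
      P[diffAt loss S obs θ₀ η α t | localInfo S obs α t] := by
  have h1 := (memLp_lossAt h_obs h_S h_loss h_sq h_bdd ht hη α).integrable one_le_two
  have h2 := (h_sq θ₀ α t ht).integrable one_le_two
  have heq : diffAt loss S obs θ₀ η α t =
      lossAt loss S obs η α t - lossAt loss S obs (fun _ => θ₀) α t := rfl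
  rw [heq]
  filter_upwards [condExp_sub h1 h2 (jointInfo S obs t), condExp_sub h1 h2 (localInfo S obs α t),
    (h_stat t ht η hη).1 α, (h_stat t ht (fun _ => θ₀) measurable_const).1 α] with ω g1 g2 g3 g4
  rw [g1, g2, Pi.sub_apply, Pi.sub_apply, g3, g4]

lemma isCentredSlice_centredDiff (h_obs : ∀ t, Measurable (obs t)) (h_S : Measurable S)
    (h_loss : Measurable fun p : Θ × O × Z => loss p.1 p.2.1 p.2.2)
    (h_sq : ∀ (θ : Θ) (α : A) (t : ℕ), 1 ≤ t → MemLp (lossAt loss S obs (fun _ => θ) α t) 2 P)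
    {G : SimpleGraph A} (h_graph : DependencyGraph P S obs G)
    (h_stat : Stationarity P loss S obs) (h_bdd : Boundedness P loss S obs θ₀ b₁ b₂)
    (ht : 1 ≤ t) (hη : Measurable[past obs (t - 1)] η) :
    IsCentredSlice P (jointInfo S obs t)
      (fun α => MeasurableSpace.comap (fun ω => obs t ω α) inferInstance) G b₂
      (centredDiff P loss S obs θ₀ η t) where
  le := (jointInfo_le_past h_S obs ht).trans (past_le h_obs t)
  le_loc α := (comap_obs_apply_le obs α t).trans (h_obs t).comap_le
  condIndep α A' hα hadj := by
    have := h_graph t ht α A' hα hadj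
    rwa [comap_restrict_eq_iSup] at this
  meas α := (measurable_diffAt h_loss θ₀ hη α).stronglyMeasurable.sub
    (stronglyMeasurable_condExp.mono le_sup_left)
  bound α := by
    filter_upwards [h_bdd.2.2.2.2 α t ht η hη,
      condExp_diffAt_jointInfo h_obs h_S h_loss h_sq h_stat h_bdd ht hη α] with ω g1 g2
    rw [centredDiff, g2]
    exact g1
  centred α := by
    have hle : jointInfo S obs t ≤ mΩ := (jointInfo_le_past h_S obs ht).trans (past_le h_obs t)
    have hi := (memLp_diffAt h_obs h_S h_loss h_bdd ht hη α).integrable one_le_two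
    have heq : centredDiff P loss S obs θ₀ η t α = diffAt loss S obs θ₀ η α t -
      P[diffAt loss S obs θ₀ η α t | jointInfo S obs t] := rfl
    rw [heq]
    filter_upwards [condExp_sub hi (integrable_condExp (m := jointInfo S obs t))
      (jointInfo S obs t)] with ω g1
    rw [g1, Pi.sub_apply,
      condExp_of_stronglyMeasurable hle stronglyMeasurable_condExp integrable_condExp]
    simp

lemma avgDiff_sub_condExp (h_obs : ∀ t, Measurable (obs t)) (h_S : Measurable S)
    (h_loss : Measurable fun p : Θ × O × Z => loss p.1 p.2.1 p.2.2)
    (h_bdd : Boundedness P loss S obs θ₀ b₁ b₂) (ht : 1 ≤ t)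
    (hη : Measurable[past obs (t - 1)] η) :
    ∀ᵐ ω ∂P, avgDiff loss S obs θ₀ η t ω -
        (P[avgDiff loss S obs θ₀ η t | jointInfo S obs t]) ω =
      1 / (Fintype.card A : ℝ) * ∑ α, centredDiff P loss S obs θ₀ η t α ω := by
  have hi := fun α => (memLp_diffAt h_obs h_S h_loss h_bdd ht hη α).integrable one_le_two
  have heq : avgDiff loss S obs θ₀ η t =
      (1 / (Fintype.card A : ℝ)) • ∑ α, diffAt loss S obs θ₀ η α t := by
    ext ω
    simp [avgDiff_eq]
  filter_upwards [condExp_smul (μ := P) (1 / (Fintype.card A : ℝ))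
      (∑ α, diffAt loss S obs θ₀ η α t) (jointInfo S obs t),
    condExp_finsetSum (fun α _ => hi α) (jointInfo S obs t) (s := Finset.univ)] with ω g1 g2
  rw [heq, g1, Pi.smul_apply, Pi.smul_apply, g2]
  simp only [smul_eq_mul, Finset.sum_apply, centredDiff, Finset.sum_sub_distrib]
  ring

/-- Expanding the square yields the moments of orders (2,0), (1,1) and (0,2) in the losses at η and
`θ₀`, each covered by stationarity. That assumption compares second moments only after summation
over α, hence the sums here. -/
lemma condExp_sum_diffAt_sq (h_obs : ∀ t, Measurable (obs t)) (h_S : Measurable S)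
    (h_loss : Measurable fun p : Θ × O × Z => loss p.1 p.2.1 p.2.2)
    (h_sq : ∀ (θ : Θ) (α : A) (t : ℕ), 1 ≤ t → MemLp (lossAt loss S obs (fun _ => θ) α t) 2 P)
    (h_stat : Stationarity P loss S obs) (h_bdd : Boundedness P loss S obs θ₀ b₁ b₂)
    (ht : 1 ≤ t) (hη : Measurable[past obs (t - 1)] η) :
    ∀ᵐ ω ∂P, ∑ α, (P[diffAt loss S obs θ₀ η α t ^ 2 | jointInfo S obs t]) ω =
      ∑ α, (P[diffAt loss S obs θ₀ η α t ^ 2 | localInfo S obs α t]) ω := by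
  have hη2 := memLp_lossAt h_obs h_S h_loss h_sq h_bdd ht hη
  have h02 := fun α => h_sq θ₀ α t ht
  let F : ℕ → ℕ → A → Ω → ℝ := fun i j α ω =>
    lossAt loss S obs η α t ω ^ i * lossAt loss S obs (fun _ => θ₀) α t ω ^ j
  have hF20 : ∀ α, Integrable (F 2 0 α) P := fun α => by
    simpa [F] using (hη2 α).integrable_sq
  have hF02 : ∀ α, Integrable (F 0 2 α) P := fun α => by
    simpa [F] using (h02 α).integrable_sq
  have hF11 : ∀ α, Integrable (F 1 1 α) P := fun α => by
    simpa [F, Pi.mul_def] using (hη2 α).integrable_mul (h02 α)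
  have hsq : ∀ α, diffAt loss S obs θ₀ η α t ^ 2 = F 2 0 α - (2 : ℝ) • F 1 1 α + F 0 2 α := by
    intro α
    ext ω
    simp only [F, diffAt, Pi.pow_apply, Pi.add_apply, Pi.sub_apply, Pi.smul_apply, smul_eq_mul]
    ring
  have hexpand : ∀ (m : MeasurableSpace Ω) (α : A), ∀ᵐ ω ∂P,
      (P[diffAt loss S obs θ₀ η α t ^ 2 | m]) ω =
        (P[F 2 0 α | m]) ω - 2 * (P[F 1 1 α | m]) ω + (P[F 0 2 α | m]) ω := by
    intro m α
    rw [hsq α]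
    filter_upwards [condExp_add ((hF20 α).sub ((hF11 α).smul (2 : ℝ))) (hF02 α) m,
      condExp_sub (hF20 α) ((hF11 α).smul (2 : ℝ)) m,
      condExp_smul (μ := P) (2 : ℝ) (F 1 1 α) m] with ω g1 g2 g3
    rw [g1, Pi.add_apply, g2, Pi.sub_apply, g3, Pi.smul_apply, smul_eq_mul]
  have hswap : ∀ i j, i + j = 2 → (∀ α, Integrable (F i j α) P) →
      ∀ᵐ ω ∂P, ∑ α, (P[F i j α | jointInfo S obs t]) ω =
        ∑ α, (P[F i j α | localInfo S obs α t]) ω := by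
    intro i j hij hi
    have heq : (fun ω => ∑ α, lossAt loss S obs η α t ω ^ i *
        lossAt loss S obs (fun _ => θ₀) α t ω ^ j) = ∑ α, F i j α := by
      ext ω
      simp [F]
    have hs := (h_stat t ht η hη).2 θ₀ i j hij
    rw [heq] at hs
    filter_upwards [hs, condExp_finsetSum (fun α _ => hi α) (jointInfo S obs t)
      (s := Finset.univ)] with ω g1 g2
    rw [← Finset.sum_apply, ← g2, g1]
  filter_upwards [ae_all_iff.2 fun α => hexpand (jointInfo S obs t) α,
    ae_all_iff.2 fun α => hexpand (localInfo S obs α t) α,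
    hswap 2 0 rfl hF20, hswap 1 1 rfl hF11, hswap 0 2 rfl hF02] with ω g1 g2 g3 g4 g5
  simp only [g1, g2, Finset.sum_add_distrib, Finset.sum_sub_distrib, ← Finset.mul_sum, g3, g4, g5]

/-- Variance is second moment minus squared mean: the means agree for each α, the second moments
after summing. So the slice variance, defined by local conditioning, is the quantity that the joint
conditioning produces. -/
lemma avgCondSq_centredDiff (h_obs : ∀ t, Measurable (obs t)) (h_S : Measurable S)
    (h_loss : Measurable fun p : Θ × O × Z => loss p.1 p.2.1 p.2.2)
    (h_sq : ∀ (θ : Θ) (α : A) (t : ℕ), 1 ≤ t → MemLp (lossAt loss S obs (fun _ => θ) α t) 2 P)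
    (h_stat : Stationarity P loss S obs) (h_bdd : Boundedness P loss S obs θ₀ b₁ b₂)
    (ht : 1 ≤ t) (hη : Measurable[past obs (t - 1)] η) :
    ∀ᵐ ω ∂P, avgCondSq P (jointInfo S obs t) (centredDiff P loss S obs θ₀ η t) ω =
      1 / (Fintype.card A : ℝ) * ∑ α,
        (Var[diffAt loss S obs θ₀ η α t ; P | localInfo S obs α t]) ω := by
  have hle : jointInfo S obs t ≤ mΩ := (jointInfo_le_past h_S obs ht).trans (past_le h_obs t)
  have hX := memLp_diffAt h_obs h_S h_loss h_bdd ht hη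
  filter_upwards [condExp_sum_diffAt_sq h_obs h_S h_loss h_sq h_stat h_bdd ht hη,
    ae_all_iff.2 fun α => condExp_diffAt_jointInfo h_obs h_S h_loss h_sq h_stat h_bdd ht hη α,
    ae_all_iff.2 fun α => condVar_ae_eq_condExp_sq_sub_sq_condExp hle (hX α),
    ae_all_iff.2 fun α => condVar_ae_eq_condExp_sq_sub_sq_condExp
      ((localInfo_le_jointInfo S obs α t).trans hle) (hX α)] with ω g1 g2 g3 g4
  have hvar : ∀ α, (P[fun ω => centredDiff P loss S obs θ₀ η t α ω ^ 2 | jointInfo S obs t]) ω =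
      (Var[diffAt loss S obs θ₀ η α t ; P | jointInfo S obs t]) ω := fun α => rfl
  simp only [avgCondSq, hvar, g3, g4, Pi.sub_apply, Pi.pow_apply, Finset.sum_sub_distrib, g1, g2]

end Slice

/-! ### The two bounds of the theorem. -/

section Bounds

variable {Ω A O Z Θ : Type*} {mΩ : MeasurableSpace Ω} [MeasurableSpace O] [MeasurableSpace Z]
  [MeasurableSpace Θ] [Fintype A] {P : Measure Ω} [IsProbabilityMeasure P]
  {obs : ℕ → Ω → A → O} {S : (A → O) → A → Z} {loss : Θ → O → Z → ℝ} {θ₀ : Θ} {b₁ b₂ : ℝ}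
  {G : SimpleGraph A} [DecidableRel G.Adj] {θ : ℕ → Ω → Θ}

lemma cast_maxDegree_add_one (G : SimpleGraph A) [DecidableRel G.Adj] :
    ((G.maxDegree + 1 : ℕ) : ℝ) = deg G := by
  rw [deg]; push_cast; ring

lemma deg_pos (G : SimpleGraph A) [DecidableRel G.Adj] : 0 < deg G := by
  rw [← cast_maxDegree_add_one]; positivity

lemma timeVar_ae_le [Nonempty A] (h_obs : ∀ t, Measurable (obs t)) (h_S : Measurable S)
    (h_loss : Measurable fun p : Θ × O × Z => loss p.1 p.2.1 p.2.2)
    (h_sq : ∀ (θ : Θ) (α : A) (t : ℕ), 1 ≤ t → MemLp (lossAt loss S obs (fun _ => θ) α t) 2 P)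
    (h_graph : DependencyGraph P S obs G) (h_stat : Stationarity P loss S obs)
    (h_bdd : Boundedness P loss S obs θ₀ b₁ b₂)
    (h_adapted : ∀ t, Measurable[past obs t] (θ t)) {t : ℕ} (ht : 1 ≤ t)
    {v₁ : ℝ} (h_v : CondVarBound P loss S obs θ₀ v₁) :
    ∀ᵐ ω ∂P, timeVar P loss S obs θ₀ θ t ω ≤ deg G / (Fintype.card A : ℝ) * v₁ := by
  obtain ⟨c, hc⟩ := exists_coloring_maxDegree G
  have hn : (0 : ℝ) < Fintype.card A := by exact_mod_cast Fintype.card_pos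
  have hstep : ∀ τ ∈ Finset.Icc 1 t, ∀ᵐ ω ∂P,
      (Var[avgDiff loss S obs θ₀ (θ (τ - 1)) τ ; P | jointInfo S obs τ]) ω ≤
        deg G / (Fintype.card A : ℝ) * v₁ := by
    intro τ hτ
    have h1 : 1 ≤ τ := (Finset.mem_Icc.1 hτ).1
    have hη := h_adapted (τ - 1)
    have hcongr : Var[avgDiff loss S obs θ₀ (θ (τ - 1)) τ ; P | jointInfo S obs τ] =ᵐ[P]
        P[fun ω => (1 / (Fintype.card A : ℝ) *
          ∑ α, centredDiff P loss S obs θ₀ (θ (τ - 1)) τ α ω) ^ 2 | jointInfo S obs τ] := by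
      refine condExp_congr_ae ?_
      filter_upwards [avgDiff_sub_condExp h_obs h_S h_loss h_bdd h1 hη] with ω hω
      rw [Pi.pow_apply, Pi.sub_apply, hω]
    filter_upwards [hcongr,
      (isCentredSlice_centredDiff h_obs h_S h_loss h_sq h_graph h_stat h_bdd h1
        hη).condExp_sq_avg_le hc,
      avgCondSq_centredDiff h_obs h_S h_loss h_sq h_stat h_bdd h1 hη,
      ae_all_iff.2 fun α => h_v α τ h1 _ hη] with ω g1 g2 g3 g4
    rw [g1]
    refine g2.trans ?_
    rw [g3, cast_maxDegree_add_one]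
    have hd := deg_pos G
    refine mul_le_mul_of_nonneg_left ?_ (by positivity)
    have h5 := Finset.sum_le_card_nsmul Finset.univ _ v₁ fun α _ => g4 α
    rw [Finset.card_univ, nsmul_eq_mul] at h5
    rw [one_div_mul_eq_div, div_le_iff₀ hn]
    linarith
  filter_upwards [(Filter.eventually_all_finset _).2 hstep] with ω hω
  have ht0 : (0 : ℝ) < t := by exact_mod_cast ht
  have h5 := Finset.sum_le_card_nsmul _ _ _ hω
  rw [Nat.card_Icc, Nat.add_sub_cancel, nsmul_eq_mul] at h5
  rw [timeVar, one_div_mul_eq_div, div_le_iff₀ ht0]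
  linarith

/-- The second term of the bracket in `v₂` is 64 times the left side, the first is a square, and
3π/2 ≥ 1. -/
lemma le_v₂ [Nonempty A] {v₁ : ℝ} (b₂ : ℝ) (hv : 0 < v₁) :
    deg G / (Fintype.card A : ℝ) * v₁ ≤ v₂ G b₂ v₁ := by
  have hd := deg_pos G
  have hn : (0 : ℝ) < Fintype.card A := by exact_mod_cast Fintype.card_pos
  have hπ := Real.pi_gt_three
  have h1 : 64 * v₁ / ((Fintype.card A : ℝ) / deg G) =
      64 * (deg G / (Fintype.card A : ℝ) * v₁) := by field_simp
  have h2 : 0 < deg G / (Fintype.card A : ℝ) * v₁ := by positivity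
  rw [v₂, h1]
  have h3 : deg G / (Fintype.card A : ℝ) * v₁ ≤
      (15 * b₂ / ((Fintype.card A : ℝ) / deg G)) ^ 2 +
        64 * (deg G / (Fintype.card A : ℝ) * v₁) := by
    linarith [sq_nonneg (15 * b₂ / ((Fintype.card A : ℝ) / deg G))]
  exact h3.trans (le_mul_of_one_le_left (h2.le.trans h3) (by linarith))

/-- One-sided exponential bound for the deviations of the empirical from the conditional risk. -/
lemma measureReal_sum_centredDiff_le [Nonempty A] (h_obs : ∀ t, Measurable (obs t))
    (h_S : Measurable S)
    (h_loss : Measurable fun p : Θ × O × Z => loss p.1 p.2.1 p.2.2)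
    (h_sq : ∀ (θ : Θ) (α : A) (t : ℕ), 1 ≤ t → MemLp (lossAt loss S obs (fun _ => θ) α t) 2 P)
    (h_graph : DependencyGraph P S obs G) (h_stat : Stationarity P loss S obs)
    (h_bdd : Boundedness P loss S obs θ₀ b₁ b₂)
    (h_adapted : ∀ t, Measurable[past obs t] (θ t)) (t : ℕ) {V x r : ℝ}
    (hr : 2 * |r| * (deg G / (Fintype.card A : ℝ)) * b₂ ≤ 1) :
    P.real {ω | t * x ≤ r * ∑ τ ∈ Finset.Icc 1 t, 1 / (Fintype.card A : ℝ) *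
          ∑ α, centredDiff P loss S obs θ₀ (θ (τ - 1)) τ α ω ∧
        ∀ τ ∈ Finset.Icc 1 t, sliceVar P loss S obs θ₀ θ τ ω ≤ V} ≤
      Real.exp (-(t * x - 4 * r ^ 2 * (deg G / (Fintype.card A : ℝ)) * (t * V))) := by
  obtain ⟨c, hc⟩ := exists_coloring_maxDegree G
  have hn : (0 : ℝ) < Fintype.card A := by exact_mod_cast Fintype.card_pos
  have hd := deg_pos G
  set Y : ℕ → A → Ω → ℝ := fun τ => centredDiff P loss S obs θ₀ (θ (τ - 1)) τ with hY
  have hslice : ∀ τ, 1 ≤ τ → IsCentredSlice P (jointInfo S obs τ)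
      (fun α => MeasurableSpace.comap (fun ω => obs τ ω α) inferInstance) G b₂ (Y τ) :=
    fun τ h1 => isCentredSlice_centredDiff h_obs h_S h_loss h_sq h_graph h_stat h_bdd h1
      (h_adapted (τ - 1))
  refine measureReal_le_exp_neg_of_condExp_exp_le (ℱ := past obs) (H := jointInfo S obs)
    (D := fun τ ω => 1 / (Fintype.card A : ℝ) * ∑ α, Y τ α ω)
    (v := fun τ => avgCondSq P (jointInfo S obs τ) (Y τ))
    (b := b₂) (r := r) (κ := 4 * r ^ 2 * (deg G / (Fintype.card A : ℝ)))
    (past_le h_obs) (fun τ => past_le_jointInfo S obs (τ + 1))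
    (fun τ h1 => jointInfo_le_past h_S obs h1) ?_
    (fun τ _ => stronglyMeasurable_avgCondSq _) ?_ (fun τ _ => avgCondSq_nonneg _)
    (by positivity) ?_ t ?_
  · exact fun τ h1 => (Finset.stronglyMeasurable_fun_sum _ fun α _ =>
      ((hslice τ h1).meas α).mono (jointInfo_sup_comap_le_past h_S h1 α)).const_mul _
  · intro τ h1
    filter_upwards [ae_all_iff.2 (hslice τ h1).bound] with ω hω
    have h2 : |∑ α, Y τ α ω| ≤ Fintype.card A * b₂ := by
      refine (Finset.abs_sum_le_sum_abs _ _).trans ?_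
      have := Finset.sum_le_card_nsmul Finset.univ _ b₂ fun α _ => hω α
      rwa [Finset.card_univ, nsmul_eq_mul] at this
    rw [abs_mul, abs_of_pos (by positivity), one_div_mul_eq_div, div_le_iff₀ hn]
    linarith
  · intro τ h1
    have h := (hslice τ h1).condExp_exp_avg_le hc (r := r)
      (by rw [cast_maxDegree_add_one]; exact hr)
    rwa [cast_maxDegree_add_one] at h
  · have hvar : ∀ τ ∈ Finset.Icc 1 t, ∀ᵐ ω ∂P,
        avgCondSq P (jointInfo S obs τ) (Y τ) ω = sliceVar P loss S obs θ₀ θ τ ω := fun τ hτ =>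
      avgCondSq_centredDiff h_obs h_S h_loss h_sq h_stat h_bdd (Finset.mem_Icc.1 hτ).1
        (h_adapted (τ - 1))
    filter_upwards [(Filter.eventually_all_finset _).2 hvar] with ω hω hmem
    have h1 : ∑ τ ∈ Finset.Icc 1 t, avgCondSq P (jointInfo S obs τ) (Y τ) ω ≤ t * V := by
      have := Finset.sum_le_card_nsmul (Finset.Icc 1 t)
        (fun τ => avgCondSq P (jointInfo S obs τ) (Y τ) ω) V
        fun τ hτ => (hω τ hτ).trans_le (hmem.2 τ hτ)
      rwa [Nat.card_Icc, Nat.add_sub_cancel, nsmul_eq_mul] at this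
    rw [Finset.sum_sub_distrib]
    refine sub_le_sub (hmem.1.trans_eq (Finset.mul_sum _ _ _)) ?_
    rw [← Finset.mul_sum]
    exact mul_le_mul_of_nonneg_left h1 (by positivity)

lemma risk_deviation_eq (h_obs : ∀ t, Measurable (obs t)) (h_S : Measurable S)
    (h_loss : Measurable fun p : Θ × O × Z => loss p.1 p.2.1 p.2.2)
    (h_sq : ∀ (θ : Θ) (α : A) (t : ℕ), 1 ≤ t → MemLp (lossAt loss S obs (fun _ => θ) α t) 2 P)
    (h_bdd : Boundedness P loss S obs θ₀ b₁ b₂)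
    (h_adapted : ∀ t, Measurable[past obs t] (θ t)) (t : ℕ) :
    ∀ᵐ ω ∂P, (empRisk loss S obs θ t ω - empRisk loss S obs (fun _ _ => θ₀) t ω) -
        (risk P loss S obs θ t ω - risk P loss S obs (fun _ _ => θ₀) t ω) =
      1 / (t : ℝ) * ∑ τ ∈ Finset.Icc 1 t, 1 / (Fintype.card A : ℝ) *
        ∑ α, centredDiff P loss S obs θ₀ (θ (τ - 1)) τ α ω := by
  have hint : ∀ τ, 1 ≤ τ → ∀ η : Ω → Θ, Measurable[past obs (τ - 1)] η →
      Integrable (avgLoss loss S obs η τ) P := fun τ h1 η hη =>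
    (integrable_finsetSum _ fun α _ => (memLp_lossAt h_obs h_S h_loss h_sq h_bdd h1 hη
      α).integrable one_le_two).const_mul _
  have hstep : ∀ τ ∈ Finset.Icc 1 t, ∀ᵐ ω ∂P,
      1 / (Fintype.card A : ℝ) * ∑ α, centredDiff P loss S obs θ₀ (θ (τ - 1)) τ α ω =
        avgLoss loss S obs (θ (τ - 1)) τ ω - avgLoss loss S obs (fun _ => θ₀) τ ω -
        ((P[avgLoss loss S obs (θ (τ - 1)) τ | jointInfo S obs τ]) ω -
          (P[avgLoss loss S obs (fun _ => θ₀) τ | jointInfo S obs τ]) ω) := by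
    intro τ hτ
    have h1 := (Finset.mem_Icc.1 hτ).1
    have heq : avgDiff loss S obs θ₀ (θ (τ - 1)) τ =
        avgLoss loss S obs (θ (τ - 1)) τ - avgLoss loss S obs (fun _ => θ₀) τ := rfl
    filter_upwards [avgDiff_sub_condExp h_obs h_S h_loss h_bdd h1 (h_adapted (τ - 1)),
      condExp_sub (hint τ h1 _ (h_adapted (τ - 1))) (hint τ h1 (fun _ => θ₀) measurable_const)
        (jointInfo S obs τ)] with ω g1 g2
    rw [← g1, heq, g2, Pi.sub_apply, Pi.sub_apply]
  filter_upwards [(Filter.eventually_all_finset _).2 hstep] with ω hω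
  rw [Finset.sum_congr rfl hω]
  simp only [empRisk, risk, Finset.sum_sub_distrib]
  ring

/-- The two-sided Chernoff bound at the parameter `x / (d (8V + 2bx))`. -/
lemma two_mul_exp_neg_le {d b V x : ℝ} {t : ℕ} (hd : 0 < d) (hb : 0 < b) (hV : 0 < V)
    (hx : 0 ≤ x) (ht : 1 ≤ t) :
    2 * Real.exp (-(t * (x / (d * (8 * V + 2 * b * x)) * x) -
        4 * (x / (d * (8 * V + 2 * b * x))) ^ 2 * d * (t * V))) ≤
      Real.exp (2 - 1 / d * x ^ 2 /
        (32 * Real.exp 1 ^ 2 * V + 15 * Real.exp 1 * b * x)) := by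
  set r := x / (d * (8 * V + 2 * b * x)) with hr
  have ht1 : (1 : ℝ) ≤ t := by exact_mod_cast ht
  have he : 2 < Real.exp 1 := lt_trans (by norm_num) Real.exp_one_gt_d9
  have hD : 0 < 8 * V + 2 * b * x := by positivity
  have hr0 : 0 ≤ r := by positivity
  have hrD : r * d * (8 * V + 2 * b * x) = x := by rw [hr]; field_simp
  -- Because 8 r d V ≤ x, the quadratic cost is at most half of the linear gain.
  have h1 : 4 * r ^ 2 * d * V ≤ r * x / 2 := by
    have h2 : 0 ≤ r * d * (b * x) := by positivity
    have h3 : r * (8 * (r * d * V)) ≤ r * x := mul_le_mul_of_nonneg_left (by linarith) hr0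
    linarith
  have h2 : r * x / 2 = 1 / d * x ^ 2 / (16 * V + 4 * b * x) := by
    rw [hr]; field_simp; ring
  have h3 : 1 / d * x ^ 2 / (32 * Real.exp 1 ^ 2 * V + 15 * Real.exp 1 * b * x) ≤ r * x / 2 := by
    rw [h2]
    -- It remains to compare denominators: 16 ≤ 32 e² and 4 ≤ 15 e.
    refine div_le_div_of_nonneg_left (by positivity) (by positivity) ?_
    have h4 : 1 ≤ Real.exp 1 ^ 2 := by nlinarith
    have h5 : V ≤ Real.exp 1 ^ 2 * V := le_mul_of_one_le_left hV.le h4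
    have h6 : b * x ≤ Real.exp 1 * (b * x) := le_mul_of_one_le_left (by positivity) (by linarith)
    have h7 : 0 ≤ b * x := by positivity
    linarith
  have h4 : r * x / 2 ≤ t * (r * x) - 4 * r ^ 2 * d * (t * V) := by
    have h5 : t * (4 * r ^ 2 * d * V) ≤ t * (r * x / 2) := by gcongr
    have h6 : r * x / 2 ≤ t * (r * x / 2) := le_mul_of_one_le_left (by positivity) ht1
    linarith
  -- The factor 2 for the two signs is absorbed into the 2 in the exponent.
  have h5 : (2 : ℝ) ≤ Real.exp 2 := by linarith [Real.add_one_le_exp (2 : ℝ)]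
  calc 2 * Real.exp (-(t * (r * x) - 4 * r ^ 2 * d * (t * V)))
      ≤ Real.exp 2 * Real.exp (-(1 / d * x ^ 2 /
        (32 * Real.exp 1 ^ 2 * V + 15 * Real.exp 1 * b * x))) := by
        gcongr
        linarith
    _ = _ := by rw [← Real.exp_add, sub_eq_add_neg]

/-- The deviation is the time average of the slice averages of centred differences; its two signs
are handled by the tilts r and -r. -/
lemma measureReal_risk_deviation_le [Nonempty A] (h_obs : ∀ t, Measurable (obs t))
    (h_S : Measurable S)
    (h_loss : Measurable fun p : Θ × O × Z => loss p.1 p.2.1 p.2.2)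
    (h_sq : ∀ (θ : Θ) (α : A) (t : ℕ), 1 ≤ t → MemLp (lossAt loss S obs (fun _ => θ) α t) 2 P)
    (h_graph : DependencyGraph P S obs G) (h_stat : Stationarity P loss S obs)
    (h_bdd : Boundedness P loss S obs θ₀ b₁ b₂)
    (h_adapted : ∀ t, Measurable[past obs t] (θ t)) {t : ℕ} (ht : 1 ≤ t) {V x : ℝ}
    (hV : 0 < V) (hx : 0 ≤ x) :
    P.real {ω | x ≤ |(empRisk loss S obs θ t ω - empRisk loss S obs (fun _ _ => θ₀) t ω) -
          (risk P loss S obs θ t ω - risk P loss S obs (fun _ _ => θ₀) t ω)| ∧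
        ∀ τ ∈ Finset.Icc 1 t, sliceVar P loss S obs θ₀ θ τ ω ≤ V} ≤
      Real.exp (2 - (Fintype.card A : ℝ) / deg G * x ^ 2 /
        (32 * Real.exp 1 ^ 2 * V + 15 * Real.exp 1 * b₂ * x)) := by
  have hn : (0 : ℝ) < Fintype.card A := by exact_mod_cast Fintype.card_pos
  have hdeg := deg_pos G
  have hb : 0 < b₂ := h_bdd.2.2.1
  have ht0 : (0 : ℝ) < t := by exact_mod_cast ht
  set d : ℝ := deg G / (Fintype.card A : ℝ) with hd
  have hd0 : 0 < d := by positivity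
  have hnd : (Fintype.card A : ℝ) / deg G = 1 / d := by rw [hd, one_div_div]
  -- The maximizer of r x - 4 r² d V is x / (8 d V); the extra 2 b₂ x in the denominator enforces 2
  -- r d b₂ ≤ 1.
  set r : ℝ := x / (d * (8 * V + 2 * b₂ * x)) with hr
  have hr0 : 0 ≤ r := by positivity
  have hrb : 2 * |r| * d * b₂ ≤ 1 := by
    have h1 : 2 * |r| * d * b₂ = 2 * b₂ * x / (8 * V + 2 * b₂ * x) := by
      rw [abs_of_nonneg hr0, hr]; field_simp
    rw [h1, div_le_one (by positivity)]
    linarith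
  let M : Ω → ℝ := fun ω => ∑ τ ∈ Finset.Icc 1 t, 1 / (Fintype.card A : ℝ) *
    ∑ α, centredDiff P loss S obs θ₀ (θ (τ - 1)) τ α ω
  let E : ℝ → Set Ω := fun q => {ω | t * (r * x) ≤ q * M ω ∧
    ∀ τ ∈ Finset.Icc 1 t, sliceVar P loss S obs θ₀ θ τ ω ≤ V}
  have hE : ∀ q, |q| = r → P.real (E q) ≤
      Real.exp (-(t * (r * x) - 4 * r ^ 2 * d * (t * V))) := by
    intro q hq
    have := measureReal_sum_centredDiff_le h_obs h_S h_loss h_sq h_graph h_stat h_bdd h_adapted t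
      (V := V) (x := r * x) (r := q) (by rw [hq, ← abs_of_nonneg hr0]; exact hrb)
    rwa [← sq_abs q, hq] at this
  rw [hnd]
  refine le_trans ?_ (two_mul_exp_neg_le hd0 hb hV hx ht)
  calc P.real _ ≤ P.real (E r ∪ E (-r)) := by
        -- An inclusion up to a null set suffices, since the deviation is identified with the sum of
        -- increments only almost surely.
        refine ENNReal.toReal_mono (measure_ne_top _ _) (measure_mono_ae ?_)
        filter_upwards [risk_deviation_eq h_obs h_S h_loss h_sq h_bdd h_adapted t]
          with ω hω hmem
        obtain ⟨h1, h2⟩ := hmem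
        rw [hω, one_div_mul_eq_div, abs_div, abs_of_pos ht0, le_div_iff₀ ht0] at h1
        rcases le_abs'.1 h1 with h3 | h3
        · refine Or.inr ⟨?_, h2⟩
          have := mul_le_mul_of_nonneg_left h3 hr0
          simp only [M]
          linarith
        · refine Or.inl ⟨?_, h2⟩
          have := mul_le_mul_of_nonneg_left h3 hr0
          simp only [M]
          linarith
    _ ≤ P.real (E r) + P.real (E (-r)) := measureReal_union_le _ _
    _ ≤ _ := by
        have h1 := hE r (abs_of_nonneg hr0)
        have h2 := hE (-r) (by rw [abs_neg, abs_of_nonneg hr0])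
        linarith

end Bounds

end SequentialSL

theorem theorem2 {Ω A O Z Θ : Type*} [MeasurableSpace Ω] [MeasurableSpace O]
    [MeasurableSpace Z] [MeasurableSpace Θ] [Fintype A] [Nonempty A]
    (P : Measure Ω) [IsProbabilityMeasure P]
    (obs : ℕ → Ω → A → O) (h_obs : ∀ t, Measurable (obs t))
    (S : (A → O) → A → Z) (h_S : Measurable S)
    (loss : Θ → O → Z → ℝ)
    (h_loss : Measurable (fun p : Θ × O × Z => loss p.1 p.2.1 p.2.2))
    (h_sq : ∀ (θ : Θ) (α : A) (t : ℕ), 1 ≤ t →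
      MemLp (SequentialSL.lossAt loss S obs (fun _ => θ) α t) 2 P)
    (G : SimpleGraph A) [DecidableRel G.Adj]
    (h_graph : SequentialSL.DependencyGraph P S obs G)
    (h_stat : SequentialSL.Stationarity P loss S obs)
    (θ₀ : Θ) (b₁ b₂ : ℝ)
    (h_bdd : SequentialSL.Boundedness P loss S obs θ₀ b₁ b₂)
    (h_var : SequentialSL.VarianceBound P loss S obs θ₀)
    (J : ℕ) (θ : Fin J → ℕ → Ω → Θ)
    (h_adapted : ∀ j t, Measurable[SequentialSL.past obs t] (θ j t))
    (j : Fin J) (t : ℕ) (ht : 1 ≤ t) :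
    (∀ v₁ : ℝ, 0 < v₁ → SequentialSL.CondVarBound P loss S obs θ₀ v₁ →
      ∀ᵐ ω ∂P, SequentialSL.timeVar P loss S obs θ₀ (θ j) t ω ≤
        SequentialSL.v₂ G b₂ v₁) ∧
    (∀ V x : ℝ, 0 < V → 0 ≤ x →
      P.real {ω |
          x ≤ |(SequentialSL.empRisk loss S obs (θ j) t ω -
                SequentialSL.empRisk loss S obs (fun _ _ => θ₀) t ω) -
              (SequentialSL.risk P loss S obs (θ j) t ω -
                SequentialSL.risk P loss S obs (fun _ _ => θ₀) t ω)| ∧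
          ∀ τ ∈ Finset.Icc 1 t, SequentialSL.sliceVar P loss S obs θ₀ (θ j) τ ω ≤ V} ≤
        Real.exp (2 - (Fintype.card A : ℝ) / SequentialSL.deg G * x ^ 2 /
          (32 * Real.exp 1 ^ 2 * V + 15 * Real.exp 1 * b₂ * x))) := by
  refine ⟨fun v₁ hv h_v => ?_, fun V x hV hx => ?_⟩
  · filter_upwards [SequentialSL.timeVar_ae_le (G := G) h_obs h_S h_loss h_sq h_graph h_stat h_bdd
      (h_adapted j) ht h_v] with ω hω
    exact hω.trans (SequentialSL.le_v₂ b₂ hv)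
  · exact SequentialSL.measureReal_risk_deviation_le h_obs h_S h_loss h_sq h_graph h_stat h_bdd
      (h_adapted j) ht hV hx
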